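/- **Setting.** Let $0\le t\le 4$, and let $\eta=\mathrm{diag}(-1,\dots,-1,1,\dots,1)$ be the $4\times4$ metric with $t$ entries $-1$. Let $\sigma_0$ be the $2\times 2$ unit matrix, $\sigma_1,\sigma_2,\sigma_3$ the Pauli matrices, and $k_a=\mathrm i$ for $a\le t$, $k_a=1$ for $a>t$. The particular spinor representation of signature $(t,4-t)$ is $$\gamma_1=k_1\,\sigma_1\otimes\sigma_0,\quad \gamma_2=k_2\,\sigma_2\otimes\sigma_0,\quad \gamma_3=k_3\,\sigma_3\otimes\sigma_1,\quad \gamma_4=k_4\,\sigma_3\otimes\sigma_2,\quad \Gamma=\sigma_3\otimes\sigma_3,\quad C=\sigma_2\otimes\sigma_1 .$$ A spinor representation $(\gamma_a,\Gamma,C)$ is called equivalent to it if it arises from it by $\gamma_a\mapsto T\gamma_aT^{-1}$, $\Gamma\mapsto T\Gamma T^{-1}$, $C^{-1}\mapsto TC^{-1}T^{\top}$ for some invertible complex $4\times 4$ matrix $T$. Fix any such representation and put $\gamma^a=\eta^{ab}\gamma_b$; repeated vector and spinor indices are summed over. Let $\Omega$ be the complex algebra of polynomials in anticommuting variables $c^a$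 ($a=1,\dots,4$) and commuting variables $\xi_i^\alpha$ ($i=1,2$; $\alpha=1,\dots,4$), with coboundary operator $$b=\frac{\mathrm i}{2}\sum_{i=1}^{2}(\gamma^aC^{-1})_{\alpha\beta}\,\xi_i^\alpha\xi_i^\beta\,\frac{\partial}{\partial c^a}$$ (left derivatives). For $\omega_1,\omega_2\in\Omega$ write $\omega_1\sim\omega_2$ if $\omega_1-\omega_2=b\,\omega_3$ for some $\omega_3\in\Omega$. Put $$\xi_i^\pm=\tfrac12\xi_i(1\pm\Gamma),\qquad x\cdot y=x^\alpha (C^{-1})_{\alpha\beta}\,y^\beta,\qquad \vartheta_i^\alpha=c^a\xi_i^\beta(\gamma_a)_\beta{}^\alpha,\qquad \vartheta_i^+=\tfrac12\vartheta_i(1+\Gamma),\qquad \Theta_{ij}=\vartheta_i^+\cdot\xi_j^+ .$$ Below, $P(\xi_1^-,\xi_2)$ etc. denotes a complex polynomial in the components of the indicated spinors. **Lemma ($H(b)$ for $D=4$, $N=2$).** (i) For every $\omega\in\Omega$: $b\,\omega=0$ if and only if there are polynomials $P(\xi_1^-,\xi_2)$, $Q(\xi_1^+,\xi_2)$, $H(\xi_1^-,\xi_2)$,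 $G(\xi_1^+,\xi_2)$ and $B(\xi_2)$ such that $$\omega\sim P(\xi_1^-,\xi_2)+Q(\xi_1^+,\xi_2)+\Theta_{12}H(\xi_1^-,\xi_2)+\Theta_{21}G(\xi_1^+,\xi_2)+(\Theta_{11}-\Theta_{22})B(\xi_2).$$ (ii) For all such polynomials $P,Q,H,G,B$, $$0\sim P(\xi_1^-,\xi_2)+Q(\xi_1^+,\xi_2)+\Theta_{12}H(\xi_1^-,\xi_2)+\Theta_{21}G(\xi_1^+,\xi_2)+(\Theta_{11}-\Theta_{22})B(\xi_2)$$ holds if and only if all of the following hold: - $P+Q=(\xi_1^-\cdot\xi_2^-)\,\xi_2^{+\alpha}\tilde P_\alpha(\xi_1^-,\xi_2)+(\xi_1^+\cdot\xi_2^+)\,\xi_2^{-\alpha}\tilde Q_\alpha(\xi_1^+,\xi_2)$ for some polynomials $\tilde P_\alpha(\xi_1^-,\xi_2)$, $\tilde Q_\alpha(\xi_1^+,\xi_2)$, $\alpha=1,\dots,4$; - $H=(\xi_1^-\cdot\xi_2^-)\,\tilde P(\xi_1^-,\xi_2)$ for some polynomial $\tilde P(\xi_1^-,\xi_2)$; -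 $G=(\xi_1^+\cdot\xi_2^+)\,\tilde Q(\xi_1^+,\xi_2)$ for some polynomial $\tilde Q(\xi_1^+,\xi_2)$; - $B=0$. -/

import Mathlib

open scoped Kronecker

namespace SusyCohomology

noncomputable section

/-! ### Spinor representations in four dimensions -/

/-- The matrix data of a spinor representation in `D = 4`: the gamma matrices with lower vector
index, the chirality matrix `Γ`, and the charge conjugation matrix `C`. The entry of `γ_a` in row
`α` and column `β` is `γ_{a α}{}^β`; the lower-index bilinear form on spinors is `C⁻¹_{αβ}`. -/
@[ext]
structure SpinorRep where
  gam : Fin 4 → Matrix (Fin 4) (Fin 4) ℂ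
  chir : Matrix (Fin 4) (Fin 4) ℂ
  chargeConj : Matrix (Fin 4) (Fin 4) ℂ

/-- The unit matrix and the three Pauli matrices. -/
def pauli : Fin 4 → Matrix (Fin 2) (Fin 2) ℂ :=
  ![1, !![0, 1; 1, 0], !![0, -Complex.I; Complex.I, 0], !![1, 0; 0, -1]]

/-- The Kronecker product `A ⊗ B` of two `2 × 2` matrices as a `4 × 4` matrix, the first factor
giving the block structure. -/
def tensor (A B : Matrix (Fin 2) (Fin 2) ℂ) : Matrix (Fin 4) (Fin 4) ℂ :=
  Matrix.reindex finProdFinEquiv finProdFinEquiv (A ⊗ₖ B)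

/-- `k_a = i` for the first `t` values of the vector index and `k_a = 1` otherwise. -/
def kFactor (t : ℕ) (a : Fin 4) : ℂ := if (a : ℕ) < t then Complex.I else 1

/-- The particular spinor representation for signature `(t, 4 - t)`. -/
def particularRep (t : ℕ) : SpinorRep where
  gam := ![kFactor t 0 • tensor (pauli 1) (pauli 0), kFactor t 1 • tensor (pauli 2) (pauli 0),
    kFactor t 2 • tensor (pauli 3) (pauli 1), kFactor t 3 • tensor (pauli 3) (pauli 2)]
  chir := tensor (pauli 3) (pauli 3)
  chargeConj := tensor (pauli 2) (pauli 1)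

/-- The change of spinor basis by an invertible matrix `T`: the objects `γ_{a α}{}^β`,
`Γ_α{}^β` and `C⁻¹_{αβ}` become `T γ_a T⁻¹`, `T Γ T⁻¹` and `T C⁻¹ Tᵀ`. -/
def SpinorRep.changeBasis (S : SpinorRep) (T : GL (Fin 4) ℂ) : SpinorRep where
  gam a := T.1 * S.gam a * (T.1)⁻¹
  chir := T.1 * S.chir * (T.1)⁻¹
  chargeConj := (T.1.transpose)⁻¹ * S.chargeConj * (T.1)⁻¹

/-- Equivalence of spinor representations. -/
def SpinorRep.IsEquivTo (S S' : SpinorRep) : Prop :=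
  ∃ T : GL (Fin 4) ℂ, S = S'.changeBasis T

/-- The diagonal entries `η_{aa} = η^{aa}` of the metric of signature `(t, 4 - t)`. -/
def metricSign (t : ℕ) (a : Fin 4) : ℂ := if (a : ℕ) < t then -1 else 1

/-- The gamma matrices with upper vector index, `γ^a = η^{ab} γ_b`. -/
def SpinorRep.gamUp (S : SpinorRep) (t : ℕ) (a : Fin 4) : Matrix (Fin 4) (Fin 4) ℂ :=
  metricSign t a • S.gam a

/-! ### Ghost polynomials -/

/-- Polynomials in the commuting supersymmetry ghosts `ξ_i^α` (`i` in `Fin N`, `α` in `Fin 4`). -/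
abbrev SusyPoly (N : ℕ) : Type := MvPolynomial (Fin N × Fin 4) ℂ

/-- The space `Ω` of polynomials in the anticommuting translation ghosts `c^a` (`a` in `Fin 4`)
and the commuting supersymmetry ghosts `ξ_i^α`, with complex coefficients. -/
abbrev GhostPoly (N : ℕ) : Type := ExteriorAlgebra (SusyPoly N) (Fin 4 → SusyPoly N)

variable {N : ℕ}

/-- The translation ghost `c^a`. -/
def cGhost (a : Fin 4) : GhostPoly N :=
  ExteriorAlgebra.ι (SusyPoly N) (Pi.single a 1 : Fin 4 → SusyPoly N)

/-- The supersymmetry ghost `ξ_i^α`. -/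
def xi (i : Fin N) (α : Fin 4) : SusyPoly N := MvPolynomial.X (i, α)

/-- The matrix `M = -i · 1` occurring in `{Q^i_α, Q^j_β} = M^{ij} (γ^a C⁻¹)_{αβ} P_a`. -/
def susyMatrix (N : ℕ) : Matrix (Fin N) (Fin N) ℂ := (-Complex.I) • (1 : Matrix _ _ ℂ)

/-- The supersymmetry ghost polynomial `-(1/2) M^{ij} (γ^a C⁻¹)_{αβ} ξ_i^α ξ_j^β`, that is, the
coefficient of `∂/∂c^a` in the coboundary operator. -/
def bCoeff (S : SpinorRep) (t : ℕ) (a : Fin 4) : SusyPoly N :=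
  ∑ i, ∑ j, ∑ α, ∑ β,
    MvPolynomial.C (-(1 / 2) * susyMatrix N i j * (S.gamUp t a * S.chargeConj⁻¹) α β) *
      (xi i α * xi j β)

/-- The coboundary operator
`b = -(1/2) M^{ij} (γ^a C⁻¹)_{αβ} ξ_i^α ξ_j^β ∂/∂c^a` on `Ω`, where `∂/∂c^a` is the left
derivative: `b` is the contraction with the linear form that sends `c^a` to `bCoeff S t a`. -/
def bOp (S : SpinorRep) (t : ℕ) : GhostPoly N →ₗ[SusyPoly N] GhostPoly N :=
  CliffordAlgebra.contractLeft
    (∑ a, bCoeff (N := N) S t a •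
      (LinearMap.proj a : (Fin 4 → SusyPoly N) →ₗ[SusyPoly N] SusyPoly N))

theorem bOp_algebraMap (S : SpinorRep) (t : ℕ) (p : SusyPoly N) :
    bOp S t (algebraMap (SusyPoly N) (GhostPoly N) p) = 0 :=
  CliffordAlgebra.contractLeft_algebraMap (Q := (0 : QuadraticForm _ (Fin 4 → SusyPoly N))) _ _

theorem bOp_cGhost_mul (S : SpinorRep) (t : ℕ) (a : Fin 4) (ω : GhostPoly N) :
    bOp S t (cGhost a * ω) = bCoeff (N := N) S t a • ω - cGhost a * bOp S t ω := by
  unfold bOp cGhost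
  refine (CliffordAlgebra.contractLeft_ι_mul _ _ _).trans ?_
  congr 2
  simp [LinearMap.sum_apply, Pi.single_apply]

theorem bOp_bOp (S : SpinorRep) (t : ℕ) (ω : GhostPoly N) : bOp S t (bOp S t ω) = 0 :=
  CliffordAlgebra.contractLeft_contractLeft _ _

/-- Equivalence in the cohomology of `b`: two ghost polynomials differ by a coboundary. -/
def CohEquiv (S : SpinorRep) (t : ℕ) (ω₁ ω₂ : GhostPoly N) : Prop :=
  ∃ ω₃ : GhostPoly N, ω₁ - ω₂ = bOp S t ω₃

/-! ### Covariant ghost polynomials -/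

/-- The components of `ξ_i^+ = (1/2) ξ_i (1 + Γ)`. -/
def xiPlus (S : SpinorRep) (i : Fin N) (α : Fin 4) : SusyPoly N :=
  ∑ β, MvPolynomial.C (((1 / 2 : ℂ) • (1 + S.chir)) β α) * xi i β

/-- The components of `ξ_i^- = (1/2) ξ_i (1 - Γ)`. -/
def xiMinus (S : SpinorRep) (i : Fin N) (α : Fin 4) : SusyPoly N :=
  ∑ β, MvPolynomial.C (((1 / 2 : ℂ) • (1 - S.chir)) β α) * xi i β

/-- The invariant product `x · y = x^α C⁻¹_{αβ} y^β` of two spinors. -/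
def spinorProd (S : SpinorRep) (x y : Fin 4 → SusyPoly N) : SusyPoly N :=
  ∑ α, ∑ β, MvPolynomial.C (S.chargeConj⁻¹ α β) * (x α * y β)

/-- `ϑ_i^α = c^a ξ_i^β γ_{a β}{}^α`. -/
def vartheta (S : SpinorRep) (i : Fin N) (α : Fin 4) : GhostPoly N :=
  ∑ a, ∑ β, (MvPolynomial.C (S.gam a β α) * xi i β : SusyPoly N) • cGhost a

/-- `ϑ_i^{+α} = (1/2) ϑ_i^β (1 + Γ)_β{}^α`. -/
def varthetaPlus (S : SpinorRep) (i : Fin N) (α : Fin 4) : GhostPoly N :=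
  ∑ β, (MvPolynomial.C (((1 / 2 : ℂ) • (1 + S.chir)) β α) : SusyPoly N) • vartheta S i β

/-- `Θ_{ij} = ϑ_i^+ · ξ_j^+ = ϑ_i^{+α} C⁻¹_{αβ} ξ_j^{+β}`. -/
def Theta (S : SpinorRep) (i j : Fin N) : GhostPoly N :=
  ∑ α, ∑ β, (MvPolynomial.C (S.chargeConj⁻¹ α β) * xiPlus S j β) • varthetaPlus S i α

/-! ### Classes of polynomials for `N = 2`

The supersymmetry ghosts `ξ_1` and `ξ_2` are `xi 0` and `xi 1`. -/

/-- Polynomials in the components of `ξ_1^-` and `ξ_2`. -/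
def polyMinus (S : SpinorRep) : Subalgebra ℂ (SusyPoly 2) :=
  Algebra.adjoin ℂ (Set.range (xiMinus S 0) ∪ Set.range (xi 1))

/-- Polynomials in the components of `ξ_1^+` and `ξ_2`. -/
def polyPlus (S : SpinorRep) : Subalgebra ℂ (SusyPoly 2) :=
  Algebra.adjoin ℂ (Set.range (xiPlus S 0) ∪ Set.range (xi 1))

/-- Polynomials in the components of `ξ_2`. -/
def polyTwo : Subalgebra ℂ (SusyPoly 2) := Algebra.adjoin ℂ (Set.range (xi 1))

/-- The ghost polynomial `P + Q + Θ₁₂ H + Θ₂₁ G + (Θ₁₁ - Θ₂₂) B`. -/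
def representative (S : SpinorRep) (P Q H G B : SusyPoly 2) : GhostPoly 2 :=
  algebraMap (SusyPoly 2) (GhostPoly 2) (P + Q) + H • Theta S 0 1 + G • Theta S 1 0 +
    B • (Theta S 0 0 - Theta S 1 1)

end

end SusyCohomology

/-!
The coboundary operator `b` is a Koszul differential. In the particular representation write
`x, y` for the components of `ξ_1^+, ξ_1^-` and `a, d` for those of `ξ_2^+, ξ_2^-`. Suitable linear
combinations `e_{αβ}` of the translation ghosts are sent by `b` to the four quadrics
`x_α y_β + a_α d_β` (`quad`), so that `Ω` with `b` is the Koszul complex of these quadrics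
(`bOp_forms`). A general representation reduces to this one by the substitution `ξ_i ↦ ξ_i T`
(`rotEquiv`), which carries `polyMinus` and `polyPlus` to the fixed rings of the projections
`x ↦ 0` (`killX`) and `y ↦ 0` (`killY`), and the invariant products and `Θ_{ij}` to explicit
polynomials.

The homology is computed by comparison with the part of highest degree in `ξ_1`. The leading
quadrics `x_α y_β` (`quadLead`) do not involve `ξ_2`, and their syzygies can be read off by divisions
by variables. Put `ϑ_α = y₂ e_{α1} - y₁ e_{α2}` and `ϑ'_β = x₂ e_{1β} - x₁ e_{2β}`. Up to
boundaries the cycles of the leading complex are, in form degrees zero, one and two,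
`P(y) + Q(x)`, `∑ P_α(y) ϑ_α + ∑ Q_β(x) ϑ'_β + B (x₁ ϑ_2 - x₂ ϑ_1)` and
`P(y) ϑ_1 ϑ_2 + Q(x) ϑ'_1 ϑ'_2`, where all coefficients may also depend on `ξ_2` and `B` depends on
`ξ_2` only (`lead_zero`, `lead_one`, `lead_two`); there are none in higher form degrees
(`lead_three`).

After `x₁ ϑ_2 - x₂ ϑ_1` is completed to a cocycle of `b`, these forms span a subcomplex for the full
differential: `b` maps `ϑ_1, ϑ_2` to multiples of `detMinus = y₂ d₁ - y₁ d₂` and `ϑ'_1, ϑ'_2` to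
multiples of `detPlus = x₂ a₁ - x₁ a₂`. Removing leading parts one after the other shows that every
form whose boundary lies in this subcomplex is a member of the subcomplex up to a boundary
(`exists_eq_add_of_leading`, applied in `koszul_zero` to `koszul_three`). Cocycles and coboundaries
therefore only have to be determined within the subcomplex, where `killX` and `killY` separate the
two chiralities: the cocycles of form degree one are the combinations
`(a₂ ϑ_1 - a₁ ϑ_2) H + (d₂ ϑ'_1 - d₁ ϑ'_2) G` plus a multiple of the completed form
(`exists_reprOne`), which are multiples of `Θ₁₂`, `Θ₂₁` and `Θ₁₁ - Θ₂₂`; no cocycles survive in form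
degree two, because there `b` multiplies by `detMinus` and `detPlus`; and `reprZero_eq_iff`,
`reprOne_eq_iff` describe the coboundaries.
-/

namespace SusyCohomology

open MvPolynomial
open scoped Matrix

/-! ### Coordinates on the ring of supersymmetry ghosts -/

namespace Coord

/-- First component of `ξ_1^+` in the particular representation. -/
noncomputable def x₁ : SusyPoly 2 := X (0, 0)
/-- Second component of `ξ_1^+` in the particular representation. -/
noncomputable def x₂ : SusyPoly 2 := X (0, 3)
/-- First component of `ξ_1^-` in the particular representation. -/
noncomputable def y₁ : SusyPoly 2 := X (0, 1)
/-- Second component of `ξ_1^-` in the particular representation. -/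
noncomputable def y₂ : SusyPoly 2 := X (0, 2)
/-- First component of `ξ_2^+` in the particular representation. -/
noncomputable def a₁ : SusyPoly 2 := X (1, 0)
/-- Second component of `ξ_2^+` in the particular representation. -/
noncomputable def a₂ : SusyPoly 2 := X (1, 3)
/-- First component of `ξ_2^-` in the particular representation. -/
noncomputable def d₁ : SusyPoly 2 := X (1, 1)
/-- Second component of `ξ_2^-` in the particular representation. -/
noncomputable def d₂ : SusyPoly 2 := X (1, 2)

end Coord

open Coord

/-- The substitution `ξ_1^+ ↦ 0`. Its fixed points are the polynomials in `ξ_1^-` and `ξ_2`. -/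
noncomputable def killX : SusyPoly 2 →ₐ[ℂ] SusyPoly 2 :=
  aeval fun v => if v = (0, 0) ∨ v = (0, 3) then 0 else X v

/-- The substitution `ξ_1^- ↦ 0`. Its fixed points are the polynomials in `ξ_1^+` and `ξ_2`. -/
noncomputable def killY : SusyPoly 2 →ₐ[ℂ] SusyPoly 2 :=
  aeval fun v => if v = (0, 1) ∨ v = (0, 2) then 0 else X v

@[simp] lemma killX_x₁ : killX x₁ = 0 := by simp [killX, x₁]
@[simp] lemma killX_x₂ : killX x₂ = 0 := by simp [killX, x₂]
@[simp] lemma killX_y₁ : killX y₁ = y₁ := by simp [killX, y₁]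
@[simp] lemma killX_y₂ : killX y₂ = y₂ := by simp [killX, y₂]
@[simp] lemma killX_a₁ : killX a₁ = a₁ := by simp [killX, a₁]
@[simp] lemma killX_a₂ : killX a₂ = a₂ := by simp [killX, a₂]
@[simp] lemma killX_d₁ : killX d₁ = d₁ := by simp [killX, d₁]
@[simp] lemma killX_d₂ : killX d₂ = d₂ := by simp [killX, d₂]
@[simp] lemma killY_x₁ : killY x₁ = x₁ := by simp [killY, x₁]
@[simp] lemma killY_x₂ : killY x₂ = x₂ := by simp [killY, x₂]
@[simp] lemma killY_y₁ : killY y₁ = 0 := by simp [killY, y₁]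
@[simp] lemma killY_y₂ : killY y₂ = 0 := by simp [killY, y₂]
@[simp] lemma killY_a₁ : killY a₁ = a₁ := by simp [killY, a₁]
@[simp] lemma killY_a₂ : killY a₂ = a₂ := by simp [killY, a₂]
@[simp] lemma killY_d₁ : killY d₁ = d₁ := by simp [killY, d₁]
@[simp] lemma killY_d₂ : killY d₂ = d₂ := by simp [killY, d₂]

@[simp] lemma killX_killX (p : SusyPoly 2) : killX (killX p) = killX p := by
  have : killX.comp killX = killX := by
    ext v
    by_cases h : v = (0, 0) ∨ v = (0, 3) <;> simp [killX, h]
  exact DFunLike.congr_fun this p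

@[simp] lemma killY_killY (p : SusyPoly 2) : killY (killY p) = killY p := by
  have : killY.comp killY = killY := by
    ext v
    by_cases h : v = (0, 1) ∨ v = (0, 2) <;> simp [killY, h]
  exact DFunLike.congr_fun this p

lemma killX_killY (p : SusyPoly 2) : killX (killY p) = killY (killX p) := by
  have : killX.comp killY = killY.comp killX := by
    ext v
    by_cases h : v = (0, 1) ∨ v = (0, 2) <;> by_cases h' : v = (0, 0) ∨ v = (0, 3) <;>
      simp [killX, killY, h, h']
  exact DFunLike.congr_fun this p

lemma exists_eq_killX_add (p : SusyPoly 2) : ∃ u v, p = killX p + x₁ * u + x₂ * v := by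
  induction p using MvPolynomial.induction_on with
  | C r => exact ⟨0, 0, by simp [killX]⟩
  | add p q hp hq =>
    obtain ⟨u, v, h⟩ := hp
    obtain ⟨u', v', h'⟩ := hq
    exact ⟨u + u', v + v', by rw [map_add]; linear_combination h + h'⟩
  | mul_X p i hp =>
    obtain ⟨u, v, h⟩ := hp
    by_cases h1 : i = (0, 0)
    · subst h1; exact ⟨p, 0, by simp [killX, x₁]; ring⟩
    by_cases h2 : i = (0, 3)
    · subst h2; exact ⟨0, p, by simp [killX, x₂]; ring⟩
    refine ⟨u * X i, v * X i, ?_⟩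
    have : killX (X i) = X i := by simp [killX, h1, h2]
    rw [map_mul, this]; linear_combination (X i) * h

lemma exists_eq_killY_add (p : SusyPoly 2) : ∃ u v, p = killY p + y₁ * u + y₂ * v := by
  induction p using MvPolynomial.induction_on with
  | C r => exact ⟨0, 0, by simp [killY]⟩
  | add p q hp hq =>
    obtain ⟨u, v, h⟩ := hp
    obtain ⟨u', v', h'⟩ := hq
    exact ⟨u + u', v + v', by rw [map_add]; linear_combination h + h'⟩
  | mul_X p i hp =>
    obtain ⟨u, v, h⟩ := hp
    by_cases h1 : i = (0, 1)
    · subst h1; exact ⟨p, 0, by simp [killY, y₁]; ring⟩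
    by_cases h2 : i = (0, 2)
    · subst h2; exact ⟨0, p, by simp [killY, y₂]; ring⟩
    refine ⟨u * X i, v * X i, ?_⟩
    have : killY (X i) = X i := by simp [killY, h1, h2]
    rw [map_mul, this]; linear_combination (X i) * h

/-- Two distinct variables form a regular sequence. -/
lemma X_syzygy {i j : Fin 2 × Fin 4} (hij : i ≠ j) {u v : SusyPoly 2}
    (h : X i * u + X j * v = 0) : ∃ w, u = X j * w ∧ v = -(X i * w) := by
  have h1 : (X j : SusyPoly 2) ∣ X i * u := ⟨-v, by linear_combination h⟩
  rcases X_dvd_mul_iff.1 h1 with h2 | ⟨w, rfl⟩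
  · rw [X_dvd_X] at h2
    simp [hij.symm] at h2
  · refine ⟨w, rfl, mul_left_cancel₀ (X_ne_zero (R := ℂ) j) ?_⟩
    linear_combination h

lemma x_syzygy {u v : SusyPoly 2} (h : x₁ * u + x₂ * v = 0) :
    ∃ w, u = x₂ * w ∧ v = -(x₁ * w) := X_syzygy (by decide) h
lemma y_syzygy {u v : SusyPoly 2} (h : y₁ * u + y₂ * v = 0) :
    ∃ w, u = y₂ * w ∧ v = -(y₁ * w) := X_syzygy (by decide) h
lemma a_syzygy {u v : SusyPoly 2} (h : a₁ * u + a₂ * v = 0) :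
    ∃ w, u = a₂ * w ∧ v = -(a₁ * w) := X_syzygy (by decide) h
lemma d_syzygy {u v : SusyPoly 2} (h : d₁ * u + d₂ * v = 0) :
    ∃ w, u = d₂ * w ∧ v = -(d₁ * w) := X_syzygy (by decide) h

lemma x₂_ne : x₂ ≠ 0 := X_ne_zero _
lemma y₂_ne : y₂ ≠ 0 := X_ne_zero _
lemma a₁_ne : a₁ ≠ 0 := X_ne_zero _
lemma a₂_ne : a₂ ≠ 0 := X_ne_zero _
lemma d₁_ne : d₁ ≠ 0 := X_ne_zero _
lemma d₂_ne : d₂ ≠ 0 := X_ne_zero _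

/-- A polynomial in `ξ_1^-` and `ξ_2` plus one in `ξ_1^+` and `ξ_2` vanishes if it lies in the
ideal of the products of a component of `ξ_1^+` with a component of `ξ_1^-`. -/
lemma add_eq_zero_of_kill {p q : SusyPoly 2} (hp : killX p = p) (hq : killY q = q)
    (hx : killX (p + q) = 0) (hy : killY (p + q) = 0) : p + q = 0 := by
  rw [map_add, hp] at hx
  rw [map_add, hq] at hy
  have h1 : killY p + killY (killX q) = 0 := by rw [← map_add, hx, map_zero]
  rw [← killX_killY, hq] at h1
  linear_combination hx + hy - h1

/-! ### The grading by the degree in `ξ_1` -/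

/-- The ring homomorphism `ξ_1 ↦ s ξ_1`, with `s` the polynomial variable; it encodes the grading
of the ghost polynomials by the degree in `ξ_1`. -/
noncomputable def scale : SusyPoly 2 →ₐ[ℂ] Polynomial (SusyPoly 2) :=
  aeval fun v => if v.1 = 0 then Polynomial.X * Polynomial.C (X v) else Polynomial.C (X v)

/-- The part of degree `n` in `ξ_1`. -/
noncomputable def comp (n : ℕ) : SusyPoly 2 →+ SusyPoly 2 :=
  ((Polynomial.lcoeff (SusyPoly 2) n).toAddMonoidHom).comp
    (scale : SusyPoly 2 →+* Polynomial (SusyPoly 2)).toAddMonoidHom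

lemma comp_apply (n : ℕ) (p : SusyPoly 2) : comp n p = (scale p).coeff n := rfl

/-- `f` is homogeneous of degree `k` in `ξ_1`. -/
structure IsHom (k : ℕ) (f : SusyPoly 2) : Prop where
  scale_eq : scale f = Polynomial.X ^ k * Polynomial.C f

lemma isHom_zero (k : ℕ) : IsHom k 0 := ⟨by simp⟩
lemma IsHom.neg {k : ℕ} {f : SusyPoly 2} (h : IsHom k f) : IsHom k (-f) :=
  ⟨by rw [map_neg, h.scale_eq, Polynomial.C_neg]; ring⟩
lemma IsHom.add {k : ℕ} {f g : SusyPoly 2} (h : IsHom k f) (h' : IsHom k g) :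
    IsHom k (f + g) :=
  ⟨by rw [map_add, h.scale_eq, h'.scale_eq, map_add, mul_add]⟩
lemma IsHom.mul {k l : ℕ} {f g : SusyPoly 2} (h : IsHom k f) (h' : IsHom l g) :
    IsHom (k + l) (f * g) :=
  ⟨by rw [map_mul, h.scale_eq, h'.scale_eq, map_mul]; ring⟩

lemma isHom_X (v : Fin 2 × Fin 4) : IsHom (if v.1 = 0 then 1 else 0) (X v) := by
  constructor
  unfold scale
  rw [aeval_X]
  split_ifs <;> simp

lemma isHom_x₁ : IsHom 1 x₁ := isHom_X (0, 0)
lemma isHom_x₂ : IsHom 1 x₂ := isHom_X (0, 3)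
lemma isHom_y₁ : IsHom 1 y₁ := isHom_X (0, 1)
lemma isHom_y₂ : IsHom 1 y₂ := isHom_X (0, 2)
lemma isHom_a₁ : IsHom 0 a₁ := isHom_X (1, 0)
lemma isHom_a₂ : IsHom 0 a₂ := isHom_X (1, 3)
lemma isHom_d₁ : IsHom 0 d₁ := isHom_X (1, 1)
lemma isHom_d₂ : IsHom 0 d₂ := isHom_X (1, 2)

lemma comp_mul {k : ℕ} {f : SusyPoly 2} (h : IsHom k f) (n : ℕ) (g : SusyPoly 2) :
    comp (n + k) (f * g) = f * comp n g := by
  rw [comp_apply, map_mul, h.scale_eq, mul_assoc, add_comm, Polynomial.coeff_X_pow_mul',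
    if_pos (by omega), Polynomial.coeff_C_mul, Nat.add_sub_cancel_left, comp_apply]

lemma comp_mul_of_lt {k : ℕ} {f : SusyPoly 2} (h : IsHom k f) {n : ℕ} (hn : n < k)
    (g : SusyPoly 2) : comp n (f * g) = 0 := by
  rw [comp_apply, map_mul, h.scale_eq, mul_assoc, Polynomial.coeff_X_pow_mul', if_neg (by omega)]

lemma IsHom.comp_eq {k : ℕ} {f : SusyPoly 2} (h : IsHom k f) (n : ℕ) :
    comp n f = if n = k then f else 0 := by
  rw [comp_apply, h.scale_eq, mul_comm, Polynomial.coeff_C_mul_X_pow]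

lemma isHom_comp (n : ℕ) (p : SusyPoly 2) : IsHom n (comp n p) := by
  induction p using MvPolynomial.induction_on generalizing n with
  | C r =>
    have h : IsHom 0 (C r : SusyPoly 2) :=
      ⟨by simp only [scale, pow_zero, one_mul]; exact aeval_C _ r⟩
    rw [h.comp_eq]
    split_ifs with h0
    · subst h0; exact h
    · exact isHom_zero n
  | add p q hp hq => rw [map_add]; exact (hp n).add (hq n)
  | mul_X p v hp =>
    have hv := isHom_X v
    rw [mul_comm]
    by_cases h : n < (if v.1 = 0 then 1 else 0)
    · rw [comp_mul_of_lt hv h]; exact isHom_zero n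
    · obtain ⟨m, rfl⟩ := Nat.exists_eq_add_of_le (not_lt.1 h)
      rw [add_comm, comp_mul hv, add_comm]
      exact hv.mul (hp m)

lemma comp_comp (n m : ℕ) (p : SusyPoly 2) : comp n (comp m p) = if n = m then comp m p else 0 :=
  (isHom_comp m p).comp_eq n

lemma eq_zero_of_comp {p : SusyPoly 2} (h : ∀ n, comp n p = 0) : p = 0 := by
  have h0 : scale p = 0 := Polynomial.ext h
  -- setting `s = 1` is a left inverse of `scale`
  have h1 : ∀ q, Polynomial.eval 1 (scale q) = q := by
    intro q
    induction q using MvPolynomial.induction_on with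
    | C r =>
      have : scale (C r) = Polynomial.C (C r) := aeval_C _ r
      rw [this, Polynomial.eval_C]
    | add p q hp hq => rw [map_add, Polynomial.eval_add, hp, hq]
    | mul_X p v hp =>
      rw [map_mul, Polynomial.eval_mul, hp, scale, aeval_X]
      split_ifs <;> simp
  rw [← h1 p, h0, Polynomial.eval_zero]

lemma exists_comp_eq_zero (p : SusyPoly 2) : ∃ n, ∀ m, n ≤ m → comp m p = 0 :=
  ⟨(scale p).natDegree + 1, fun _ hm =>
    Polynomial.coeff_eq_zero_of_natDegree_lt (Nat.lt_of_succ_le hm)⟩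

/-- Setting some of the variables to zero commutes with taking homogeneous parts. -/
lemma comp_comm {f : SusyPoly 2 →ₐ[ℂ] SusyPoly 2} (hf : ∀ v, f (X v) = 0 ∨ f (X v) = X v)
    (n : ℕ) (p : SusyPoly 2) : comp n (f p) = f (comp n p) := by
  induction p using MvPolynomial.induction_on generalizing n with
  | C r =>
    have h : IsHom 0 (C r : SusyPoly 2) :=
      ⟨by simp only [scale, pow_zero, one_mul]; exact aeval_C _ r⟩
    have h' : f (C r) = C r := f.commutes r
    rw [h', h.comp_eq]
    split_ifs <;> simp [h']
  | add p q hp hq => simp only [map_add, hp, hq]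
  | mul_X p v hp =>
    have hv := isHom_X v
    rw [mul_comm, map_mul f]
    by_cases h : n < (if v.1 = 0 then 1 else 0)
    · rcases hf v with h0 | h0 <;> rw [h0, comp_mul_of_lt hv h]
      · simp
      · rw [comp_mul_of_lt hv h, map_zero]
    · obtain ⟨m, rfl⟩ := Nat.exists_eq_add_of_le (not_lt.1 h)
      rw [add_comm, comp_mul hv, map_mul f]
      rcases hf v with h0 | h0 <;> rw [h0]
      · simp
      · rw [comp_mul hv, hp]

lemma comp_killX (n : ℕ) (p : SusyPoly 2) : comp n (killX p) = killX (comp n p) :=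
  comp_comm (fun v => by unfold killX; rw [aeval_X]; split_ifs <;> simp) n p

lemma comp_killY (n : ℕ) (p : SusyPoly 2) : comp n (killY p) = killY (comp n p) :=
  comp_comm (fun v => by unfold killY; rw [aeval_X]; split_ifs <;> simp) n p

/-! ### The Koszul complex on four elements -/

section Koszul

variable {R : Type*} [CommRing R]

/-- The Koszul differential of `q 0, …, q 3` in form degree one. -/
def kos₁ (q : Fin 4 → R) : Matrix (Fin 1) (Fin 4) R := !![q 0, q 1, q 2, q 3]

/-- The Koszul differential of `q 0, …, q 3` in form degree two. Two-forms have the basis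
`01, 02, 03, 12, 13, 23`. -/
def kos₂ (q : Fin 4 → R) : Matrix (Fin 4) (Fin 6) R :=
  !![-q 1, -q 2, -q 3, 0, 0, 0;
     q 0, 0, 0, -q 2, -q 3, 0;
     0, q 0, 0, q 1, 0, -q 3;
     0, 0, q 0, 0, q 1, q 2]

/-- The Koszul differential of `q 0, …, q 3` in form degree three. Three-forms have the basis
`012, 013, 023, 123`. -/
def kos₃ (q : Fin 4 → R) : Matrix (Fin 6) (Fin 4) R :=
  !![q 2, q 3, 0, 0;
     -q 1, 0, q 3, 0;
     0, -q 1, -q 2, 0;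
     q 0, 0, 0, q 3;
     0, q 0, 0, -q 2;
     0, 0, q 0, q 1]

/-- The Koszul differential of `q 0, …, q 3` in form degree four. -/
def kos₄ (q : Fin 4 → R) : Matrix (Fin 4) (Fin 1) R := !![-q 3; q 2; -q 1; q 0]

lemma kos₁_add (q r : Fin 4 → R) : kos₁ (q + r) = kos₁ q + kos₁ r := by
  ext i j; fin_cases i; fin_cases j <;> simp [kos₁]
lemma kos₂_add (q r : Fin 4 → R) : kos₂ (q + r) = kos₂ q + kos₂ r := by
  ext i j; fin_cases i <;> fin_cases j <;> simp [kos₂, add_comm]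
lemma kos₃_add (q r : Fin 4 → R) : kos₃ (q + r) = kos₃ q + kos₃ r := by
  ext i j; fin_cases i <;> fin_cases j <;> simp [kos₃, add_comm]
lemma kos₄_add (q r : Fin 4 → R) : kos₄ (q + r) = kos₄ q + kos₄ r := by
  ext i j; fin_cases i <;> fin_cases j <;> simp [kos₄, add_comm]

lemma kos₁_mul_kos₂ (q : Fin 4 → R) : kos₁ q * kos₂ q = 0 := by
  ext i j; fin_cases i; fin_cases j <;> simp [kos₁, kos₂, Matrix.mul_apply, Fin.sum_univ_succ] <;>
    ring
lemma kos₂_mul_kos₃ (q : Fin 4 → R) : kos₂ q * kos₃ q = 0 := by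
  ext i j; fin_cases i <;> fin_cases j <;>
    simp [kos₂, kos₃, Matrix.mul_apply, Fin.sum_univ_succ] <;> ring
lemma kos₃_mul_kos₄ (q : Fin 4 → R) : kos₃ q * kos₄ q = 0 := by
  ext i j; fin_cases i <;> fin_cases j <;>
    simp [kos₃, kos₄, Matrix.mul_apply, Fin.sum_univ_succ] <;> ring

lemma kos₁_mulVec (q p : Fin 4 → R) :
    kos₁ q *ᵥ p = ![q 0 * p 0 + q 1 * p 1 + q 2 * p 2 + q 3 * p 3] := by
  ext i; fin_cases i; simp [kos₁, Matrix.mulVec, dotProduct, Fin.sum_univ_succ]; ring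
lemma kos₂_mulVec (q : Fin 4 → R) (p : Fin 6 → R) :
    kos₂ q *ᵥ p = ![-(q 1 * p 0 + q 2 * p 1 + q 3 * p 2), q 0 * p 0 - q 2 * p 3 - q 3 * p 4,
      q 0 * p 1 + q 1 * p 3 - q 3 * p 5, q 0 * p 2 + q 1 * p 4 + q 2 * p 5] := by
  ext i; fin_cases i <;> simp [kos₂, Matrix.mulVec, dotProduct, Fin.sum_univ_succ] <;>
    ring
lemma kos₃_mulVec (q p : Fin 4 → R) :
    kos₃ q *ᵥ p = ![q 2 * p 0 + q 3 * p 1, -(q 1 * p 0) + q 3 * p 2, -(q 1 * p 1 + q 2 * p 2),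
      q 0 * p 0 + q 3 * p 3, q 0 * p 1 - q 2 * p 3, q 0 * p 2 + q 1 * p 3] := by
  ext i; fin_cases i <;> simp [kos₃, Matrix.mulVec, dotProduct, Fin.sum_univ_succ] <;> ring
lemma kos₄_mulVec (q : Fin 4 → R) (p : Fin 1 → R) :
    kos₄ q *ᵥ p = ![-(q 3 * p 0), q 2 * p 0, -(q 1 * p 0), q 0 * p 0] := by
  ext i; fin_cases i <;> simp [kos₄, Matrix.mulVec, dotProduct]

end Koszul

/-! ### Reduction to leading parts -/

/-- The part of degree `n` in `ξ_1` of a vector of ghost polynomials. -/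
noncomputable def compV {ι : Type*} (n : ℕ) (p : ι → SusyPoly 2) : ι → SusyPoly 2 :=
  fun i => comp n (p i)

section Filtration

variable {ι κ l : Type*}

lemma compV_zero (n : ℕ) : compV n (0 : ι → SusyPoly 2) = 0 := by ext1; simp [compV]
lemma compV_add (n : ℕ) (p q : ι → SusyPoly 2) : compV n (p + q) = compV n p + compV n q := by
  ext1; simp [compV]
lemma compV_sub (n : ℕ) (p q : ι → SusyPoly 2) : compV n (p - q) = compV n p - compV n q := by
  ext1; simp [compV]
lemma compV_compV (n m : ℕ) (p : ι → SusyPoly 2) :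
    compV n (compV m p) = if n = m then compV m p else 0 := by
  ext1 i
  simp only [compV, comp_comp]
  split_ifs <;> rfl

variable [Fintype ι]

lemma compV_mulVec {k : ℕ} {M : Matrix κ ι (SusyPoly 2)} (hM : ∀ i j, IsHom k (M i j)) (n : ℕ)
    (p : ι → SusyPoly 2) : compV (n + k) (M *ᵥ p) = M *ᵥ compV n p := by
  ext1 i
  simp only [compV, Matrix.mulVec, dotProduct, map_sum]
  exact Finset.sum_congr rfl fun j _ => comp_mul (hM i j) n _

lemma compV_mulVec_zero {M : Matrix κ ι (SusyPoly 2)} (hM : ∀ i j, IsHom 0 (M i j)) (n : ℕ)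
    (p : ι → SusyPoly 2) : compV n (M *ᵥ p) = M *ᵥ compV n p := compV_mulVec hM n p

lemma compV_mulVec_of_lt {k : ℕ} {M : Matrix κ ι (SusyPoly 2)} (hM : ∀ i j, IsHom k (M i j))
    {n : ℕ} (hn : n < k) (p : ι → SusyPoly 2) : compV n (M *ᵥ p) = 0 := by
  ext1 i
  simp only [compV, Matrix.mulVec, dotProduct, map_sum]
  exact Finset.sum_eq_zero fun j _ => comp_mul_of_lt (hM i j) hn _

variable [Fintype l]

/-- Let `β + δ` and `β' + δ'` be consecutive differentials with `β`, `β'` of degree two and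
`δ`, `δ'` of degree zero in `ξ_1`. If the subcomplex `G` computes the homology of the leading
parts `β`, `β'`, and every element of `G` is the leading part of an element of the subcomplex
`H`, then `H` computes the homology of the full differentials. The proof removes leading parts
one after the other. -/
theorem exists_eq_add_of_leading (β δ : Matrix κ ι (SusyPoly 2)) (β' δ' : Matrix ι l (SusyPoly 2))
    (hβ : ∀ i j, IsHom 2 (β i j)) (hδ : ∀ i j, IsHom 0 (δ i j))
    (hβ' : ∀ i j, IsHom 2 (β' i j)) (hδ' : ∀ i j, IsHom 0 (δ' i j))
    (hbb : (β + δ) * (β' + δ') = 0)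
    (Hκ Gκ : Set (κ → SusyPoly 2)) (Hι Gι : Set (ι → SusyPoly 2))
    (hsub : ∀ h ∈ Hκ, ∀ h' ∈ Hκ, h - h' ∈ Hκ)
    (hzero : 0 ∈ Hι) (hadd : ∀ h ∈ Hι, ∀ h' ∈ Hι, h + h' ∈ Hι)
    (hmap : ∀ h ∈ Hι, (β + δ) *ᵥ h ∈ Hκ)
    (htop : ∀ h ∈ Hκ, ∀ n, compV (n + 2) h ∈ Gκ)
    (hlift : ∀ g ∈ Gι, ∀ n, ∃ h ∈ Hι, compV n h = compV n g ∧ ∀ m, n < m → compV m h = 0)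
    (hlead : ∀ p, β *ᵥ p ∈ Gκ → ∃ g ∈ Gι, ∃ η, p = g + β' *ᵥ η)
    (p : ι → SusyPoly 2) (hp : (β + δ) *ᵥ p ∈ Hκ) :
    ∃ h ∈ Hι, ∃ η, p = h + (β' + δ') *ᵥ η := by
  have key : ∀ n, ∀ p : ι → SusyPoly 2, (∀ m, n ≤ m → compV m p = 0) → (β + δ) *ᵥ p ∈ Hκ →
      ∃ h ∈ Hι, ∃ η, p = h + (β' + δ') *ᵥ η := by
    intro n
    induction n with
    | zero =>
      intro p hp _
      refine ⟨0, hzero, 0, ?_⟩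
      have h0 : p = 0 := by
        ext1 i
        exact eq_zero_of_comp fun n => congrFun (hp n (Nat.zero_le n)) i
      rw [h0, Matrix.mulVec_zero, add_zero]
    | succ n ih =>
      intro p hpn hpH
      have h1 : β *ᵥ compV n p ∈ Gκ := by
        have h2 := htop _ hpH n
        rwa [Matrix.add_mulVec, compV_add, compV_mulVec hβ, compV_mulVec_zero hδ,
          hpn (n + 2) (by omega), Matrix.mulVec_zero, add_zero] at h2
      obtain ⟨g, hg, η, hη⟩ := hlead _ h1
      obtain ⟨h, hh, hhn, hhm⟩ := hlift g hg n
      -- the part of `η` that contributes to degree `n`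
      obtain ⟨η', hη'n, hη'm⟩ : ∃ η', compV n ((β' + δ') *ᵥ η') = compV n (β' *ᵥ η) ∧
          ∀ m, n < m → compV m ((β' + δ') *ᵥ η') = 0 := by
        by_cases hn : n < 2
        · refine ⟨0, ?_, fun m _ => ?_⟩
          · rw [compV_mulVec_of_lt hβ' hn, Matrix.mulVec_zero, compV_zero]
          · rw [Matrix.mulVec_zero, compV_zero]
        · obtain ⟨k, rfl⟩ := Nat.exists_eq_add_of_le' (not_lt.1 hn)
          refine ⟨compV k η, ?_, fun m hm => ?_⟩
          · rw [Matrix.add_mulVec, compV_add, compV_mulVec hβ', compV_mulVec hβ',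
              compV_mulVec_zero hδ', compV_compV, compV_compV, if_pos rfl,
              if_neg (by omega), Matrix.mulVec_zero, add_zero]
          · obtain ⟨j, rfl⟩ := Nat.exists_eq_add_of_le' (show 2 ≤ m by omega)
            rw [Matrix.add_mulVec, compV_add, compV_mulVec hβ',
              compV_mulVec_zero hδ', compV_compV, compV_compV, if_neg (by omega), if_neg (by omega),
              Matrix.mulVec_zero, Matrix.mulVec_zero, add_zero]
      obtain ⟨h', hh', η'', hη''⟩ := ih (p - h - (β' + δ') *ᵥ η') (by
        intro m hm
        rw [compV_sub, compV_sub]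
        rcases hm.eq_or_lt with rfl | hm
        · rw [hhn, hη'n, sub_sub, ← compV_add, ← hη, compV_compV, if_pos rfl, sub_self]
        · rw [hpn m hm, hhm m hm, hη'm m hm, sub_zero, sub_zero]) (by
        rw [Matrix.mulVec_sub, Matrix.mulVec_sub, Matrix.mulVec_mulVec, hbb, Matrix.zero_mulVec,
          sub_zero]
        exact hsub _ hpH _ (hmap h hh))
      refine ⟨h + h', hadd _ hh _ hh', η' + η'', ?_⟩
      rw [Matrix.mulVec_add, eq_add_of_sub_eq (eq_add_of_sub_eq hη'')]
      abel
  choose n hn using fun i => exists_comp_eq_zero (p i)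
  refine key (∑ i, n i) p (fun m hm => funext fun i => hn i m ?_) hp
  exact (Finset.single_le_sum (fun j _ => Nat.zero_le (n j)) (Finset.mem_univ i)).trans hm

end Filtration

/-! ### The quadrics and the harmonic subcomplex -/

/-- The products `ξ_1^{+α} ξ_1^{-β}`, in the order `11, 12, 21, 22`. -/
noncomputable def quadLead : Fin 4 → SusyPoly 2 := ![x₁ * y₁, x₁ * y₂, x₂ * y₁, x₂ * y₂]

/-- The products `ξ_2^{+α} ξ_2^{-β}`, in the order `11, 12, 21, 22`. -/
noncomputable def quadTwo : Fin 4 → SusyPoly 2 := ![a₁ * d₁, a₁ * d₂, a₂ * d₁, a₂ * d₂]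

/-- The quadrics `∑ i, ξ_i^{+α} ξ_i^{-β}`, in the order `11, 12, 21, 22`. -/
noncomputable def quad : Fin 4 → SusyPoly 2 := quadLead + quadTwo

/-- The one-form `x₁ ϑ_2 - x₂ ϑ_1`, with `ϑ_α = y₂ e_{α1} - y₁ e_{α2}` and the basic one-forms
`e_{αβ}` in the order `11, 12, 21, 22`. -/
noncomputable def kappaLead : Fin 4 → SusyPoly 2 :=
  ![-(x₂ * y₂), x₂ * y₁, x₁ * y₂, -(x₁ * y₁)]

/-- The completion of `kappaLead` to a cocycle, by the subtraction of its analogue for `ξ_2`; a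
multiple of `Θ₁₁ - Θ₂₂`. -/
noncomputable def kappa : Fin 4 → SusyPoly 2 :=
  ![-(x₂ * y₂) + a₂ * d₂, x₂ * y₁ - a₂ * d₁, x₁ * y₂ - a₁ * d₂, -(x₁ * y₁) + a₁ * d₁]

/-- The one-form `∑ α, P_α ϑ_α + ∑ β, Q_β ϑ'_β + B k`, with `ϑ_α = y₂ e_{α1} - y₁ e_{α2}` and
`ϑ'_β = x₂ e_{1β} - x₁ e_{2β}`. -/
noncomputable def harm₁ (k : Fin 4 → SusyPoly 2) (P₁ P₂ Q₁ Q₂ B : SusyPoly 2) :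
    Fin 4 → SusyPoly 2 :=
  ![y₂ * P₁ + x₂ * Q₁ + k 0 * B, -(y₁ * P₁) + x₂ * Q₂ + k 1 * B,
    y₂ * P₂ - x₁ * Q₁ + k 2 * B, -(y₁ * P₂) - x₁ * Q₂ + k 3 * B]

/-- The two-form `P ϑ_1 ϑ_2 + Q ϑ'_1 ϑ'_2`. -/
noncomputable def harm₂ (P Q : SusyPoly 2) : Fin 6 → SusyPoly 2 :=
  ![x₂ * x₂ * Q, y₂ * y₂ * P, -(y₁ * y₂ * P) - x₁ * x₂ * Q, -(y₁ * y₂ * P) + x₁ * x₂ * Q,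
    y₁ * y₁ * P, x₁ * x₁ * Q]

/-- Harmonic zero-forms: sums of a polynomial in `ξ_1^-, ξ_2` and one in `ξ_1^+, ξ_2`. -/
def Harm₀ : Set (Fin 1 → SusyPoly 2) :=
  {h | ∃ P Q, killX P = P ∧ killY Q = Q ∧ h = ![P + Q]}

/-- Harmonic one-forms, with `k` either `kappa` or its leading part. -/
def Harm₁ (k : Fin 4 → SusyPoly 2) : Set (Fin 4 → SusyPoly 2) :=
  {h | ∃ P₁ P₂ Q₁ Q₂ B, killX P₁ = P₁ ∧ killX P₂ = P₂ ∧ killY Q₁ = Q₁ ∧ killY Q₂ = Q₂ ∧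
    killX B = B ∧ killY B = B ∧ h = harm₁ k P₁ P₂ Q₁ Q₂ B}

/-- Harmonic two-forms. -/
def Harm₂ : Set (Fin 6 → SusyPoly 2) :=
  {h | ∃ P Q, killX P = P ∧ killY Q = Q ∧ h = harm₂ P Q}

/-! ### Homology of the leading Koszul complex -/

/-- Every polynomial is harmonic modulo the leading quadrics. -/
lemma lead_zero (p : Fin 1 → SusyPoly 2) : ∃ g ∈ Harm₀, ∃ η, p = g + kos₁ quadLead *ᵥ η := by
  obtain ⟨u, v, h⟩ := exists_eq_killX_add (p 0)
  obtain ⟨u₁, u₂, hu⟩ := exists_eq_killY_add u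
  obtain ⟨v₁, v₂, hv⟩ := exists_eq_killY_add v
  refine ⟨_, ⟨killX (p 0), x₁ * killY u + x₂ * killY v, by simp, by simp, rfl⟩,
    ![u₁, u₂, v₁, v₂], ?_⟩
  rw [kos₁_mulVec]
  ext1 i; fin_cases i
  simp [quadLead]
  linear_combination h + x₁ * hu + x₂ * hv

/-- All multiples of `kappaLead` reduce to multiples by polynomials in `ξ_2`. -/
lemma kappaLead_mul (r : SusyPoly 2) :
    ∃ η : Fin 6 → SusyPoly 2,
      (fun i => kappaLead i * r) = (fun i => kappaLead i * killX (killY r)) +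
        kos₂ quadLead *ᵥ η := by
  obtain ⟨t₁, t₂, h⟩ := exists_eq_killY_add r
  obtain ⟨s₁, s₂, h'⟩ := exists_eq_killX_add (killY r)
  refine ⟨![2 * x₂ * s₁, 2 * y₂ * t₁, -(x₁ * s₁) + x₂ * s₂ - y₁ * t₁ + y₂ * t₂,
    x₁ * s₁ - x₂ * s₂ - y₁ * t₁ + y₂ * t₂, -(2 * y₁ * t₂), -(2 * x₁ * s₂)], ?_⟩
  rw [kos₂_mulVec]
  ext1 i
  fin_cases i <;> simp [quadLead, kappaLead]
  · linear_combination -(x₂ * y₂) * (h + h')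
  · linear_combination (x₂ * y₁) * (h + h')
  · linear_combination (x₁ * y₂) * (h + h')
  · linear_combination -(x₁ * y₁) * (h + h')

lemma exists_two_mul (r : SusyPoly 2) : ∃ s, r = 2 * s :=
  ⟨C (1 / 2) * r, by
    have : (2 : SusyPoly 2) = C 2 := (map_ofNat C 2).symm
    rw [this, ← mul_assoc, ← C_mul]; norm_num⟩

/-- The syzygies of the leading quadrics. -/
lemma lead_one (p : Fin 4 → SusyPoly 2) (hp : kos₁ quadLead *ᵥ p ∈ Harm₀) :
    ∃ g ∈ Harm₁ kappaLead, ∃ η, p = g + kos₂ quadLead *ᵥ η := by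
  obtain ⟨P, Q, hP, hQ, hPQ⟩ := hp
  have h0 := congrFun hPQ 0
  simp only [kos₁_mulVec, quadLead, Matrix.cons_val] at h0
  have h1 : P + Q = 0 := by
    refine add_eq_zero_of_kill hP hQ ?_ ?_ <;> rw [← h0] <;> simp
  rw [h1] at h0
  obtain ⟨u, hu1, hu2⟩ := x_syzygy (u := y₁ * p 0 + y₂ * p 1) (v := y₁ * p 2 + y₂ * p 3)
    (by linear_combination h0)
  -- `u` lies in the ideal of `ξ_1^-`, since its product with `x₂` does
  obtain ⟨u₁, u₂, hu⟩ : ∃ u₁ u₂, u = y₁ * u₁ + y₂ * u₂ := by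
    obtain ⟨u₁, u₂, hu⟩ := exists_eq_killY_add u
    have h2 := congrArg killY hu1
    simp [x₂_ne] at h2
    exact ⟨u₁, u₂, by linear_combination hu + h2⟩
  subst hu
  obtain ⟨r₁, hr1, hr2⟩ := y_syzygy (u := p 0 - x₂ * u₁) (v := p 1 - x₂ * u₂)
    (by linear_combination hu1)
  obtain ⟨r₂, hr3, hr4⟩ := y_syzygy (u := p 2 + x₁ * u₁) (v := p 3 + x₁ * u₂)
    (by linear_combination hu2)
  obtain ⟨r₁₁, r₁₂, hr₁⟩ := exists_eq_killX_add r₁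
  obtain ⟨r₂₁, r₂₂, hr₂⟩ := exists_eq_killX_add r₂
  obtain ⟨u₁₁, u₁₂, hu₁⟩ := exists_eq_killY_add u₁
  obtain ⟨u₂₁, u₂₂, hu₂⟩ := exists_eq_killY_add u₂
  obtain ⟨r, hr⟩ := exists_two_mul (r₂₁ - r₁₂)
  obtain ⟨u, hu⟩ := exists_two_mul (u₂₁ - u₁₂)
  obtain ⟨η, hη⟩ := kappaLead_mul (r + u)
  refine ⟨_, ⟨killX r₁, killX r₂, killY u₁, killY u₂, killX (killY (r + u)), by simp, by simp,
    by simp, by simp, by simp, by rw [← killX_killY]; simp, rfl⟩,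
    ![-r₁₁, -u₁₁, -r₁₂ - u₁₂ - r - u, r₁₂ - u₁₂ + r - u, -u₂₂, -r₂₂] + η, ?_⟩
  rw [Matrix.mulVec_add]
  have e : ∀ i, (kos₂ quadLead *ᵥ η) i =
      kappaLead i * (r + u) - kappaLead i * killX (killY (r + u)) := fun i => by
    have := congrFun hη i
    simp only [Pi.add_apply] at this
    linear_combination -this
  ext1 i
  rw [Pi.add_apply, Pi.add_apply, e, kos₂_mulVec]
  generalize killX (killY (r + u)) = B
  fin_cases i <;> simp [quadLead, kappaLead, harm₁]
  · linear_combination hr1 + y₂ * hr₁ + x₂ * hu₁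
  · linear_combination hr2 - y₁ * hr₁ + x₂ * hu₂ + x₂ * y₁ * hu
  · linear_combination hr3 + y₂ * hr₂ - x₁ * hu₁ + x₁ * y₂ * hr
  · linear_combination hr4 - y₁ * hr₂ - x₁ * hu₂ - x₁ * y₁ * (hr + hu)

/-- The second syzygies of the leading quadrics that are cycles; all those of `lead_two` turn out to
be of this kind. -/
lemma lead_two_of_eq_zero (p : Fin 6 → SusyPoly 2) (hp : kos₂ quadLead *ᵥ p = 0) :
    ∃ g ∈ Harm₂, ∃ η, p = g + kos₃ quadLead *ᵥ η := by
  rw [kos₂_mulVec] at hp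
  have e0 := congrFun hp 0
  have e1 := congrFun hp 1
  have e2 := congrFun hp 2
  have e3 := congrFun hp 3
  simp [quadLead] at e0 e1 e2 e3
  -- the components along two equal first indices are divisible by a component of `ξ_1^+`
  obtain ⟨s, hs, hs'⟩ := x_syzygy (u := y₂ * p 0) (v := y₁ * p 1 + y₂ * p 2)
    (by linear_combination -e0)
  obtain ⟨t', ht, ht'⟩ := x_syzygy (u := y₁ * p 1 + y₂ * p 3) (v := -(y₂ * p 5))
    (by linear_combination e2)
  obtain ⟨σ, hσ, hσ'⟩ := X_syzygy (i := (0, 2)) (j := (0, 3)) (by decide) (u := p 0) (v := -s)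
    (by change y₂ * _ + x₂ * _ = 0; linear_combination hs)
  obtain ⟨τ, hτ, hτ'⟩ := X_syzygy (i := (0, 2)) (j := (0, 0)) (by decide) (u := p 5) (v := -t')
    (by change y₂ * _ + x₁ * _ = 0; linear_combination -ht')
  change p 0 = x₂ * σ at hσ
  change -s = -(y₂ * σ) at hσ'
  change p 5 = x₁ * τ at hτ
  change -t' = -(y₂ * τ) at hτ'
  obtain ⟨w, hw, hw'⟩ := y_syzygy (u := p 1) (v := p 2 + x₁ * σ)
    (by linear_combination hs' + x₁ * hσ')
  have h3 : p 3 = x₂ * τ - y₁ * w := by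
    refine mul_left_cancel₀ y₂_ne ?_
    linear_combination ht - x₂ * hτ' - y₁ * hw
  have h4 : y₁ * (x₁ * σ - x₂ * τ + y₁ * w) + y₂ * (-p 4) = 0 := by
    refine mul_left_cancel₀ x₂_ne ?_
    linear_combination e1 - x₁ * y₁ * hσ + x₂ * y₁ * h3
  obtain ⟨v, hv, hv'⟩ := y_syzygy h4
  -- what remains is a syzygy of the four variables of `ξ_1`
  obtain ⟨v₁, v₂, hv₁⟩ := exists_eq_killX_add v
  obtain ⟨w₁, w₂, hw₁⟩ := exists_eq_killX_add w
  have h5 : y₁ * killX w + y₂ * (-killX v) = 0 := by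
    have := congrArg killX hv
    simp at this
    linear_combination this
  obtain ⟨r, hr, hr'⟩ := y_syzygy h5
  have hrk : killX r = r := by
    have := congrArg killX hr
    rw [killX_killX, map_mul, killX_y₂, hr] at this
    exact (mul_left_cancel₀ y₂_ne this).symm
  obtain ⟨z, hz, hz'⟩ := x_syzygy (u := y₂ * v₁ - y₁ * w₁ - σ) (v := y₂ * v₂ - y₁ * w₂ + τ)
    (by linear_combination y₁ * hw₁ + y₁ * hr - hv - y₂ * hv₁ + y₂ * hr')
  obtain ⟨z₁, z₂, hz₁⟩ := exists_eq_killY_add z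
  refine ⟨_, ⟨r, -killY z, hrk, by simp, rfl⟩,
    ![-w₁ - x₂ * z₁, v₁ - x₂ * z₂, w₂ - x₁ * z₁, -v₂ - x₁ * z₂], ?_⟩
  rw [kos₃_mulVec]
  have hσ₂ : σ = y₂ * v₁ - y₁ * w₁ - x₂ * z := by linear_combination -hz
  have hτ₂ : τ = -(x₁ * z) - y₂ * v₂ + y₁ * w₂ := by linear_combination hz'
  have hv₂ : v = y₁ * r + x₁ * v₁ + x₂ * v₂ := by linear_combination hv₁ - hr'
  have hw₂ : w = y₂ * r + x₁ * w₁ + x₂ * w₂ := by linear_combination hw₁ + hr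
  have h2 : p 2 = -(x₁ * σ) - y₁ * w := by linear_combination hw'
  have h4' : p 4 = y₁ * v := by linear_combination -hv'
  ext1 i
  fin_cases i <;> simp [quadLead, harm₂]
  · rw [hσ, hσ₂]; linear_combination -(x₂ * x₂) * hz₁
  · rw [hw, hw₂]; ring
  · rw [h2, hσ₂, hw₂]; linear_combination (x₁ * x₂) * hz₁
  · rw [h3, hτ₂, hw₂]; linear_combination -(x₁ * x₂) * hz₁
  · rw [h4', hv₂]; ring
  · rw [hτ, hτ₂]; linear_combination -(x₁ * x₁) * hz₁

/-- The second syzygies of the leading quadrics. -/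
lemma lead_two (p : Fin 6 → SusyPoly 2) (hp : kos₂ quadLead *ᵥ p ∈ Harm₁ kappaLead) :
    ∃ g ∈ Harm₂, ∃ η, p = g + kos₃ quadLead *ᵥ η := by
  obtain ⟨P₁, P₂, Q₁, Q₂, B, hP₁, hP₂, hQ₁, hQ₂, hBx, hBy, h⟩ := hp
  refine lead_two_of_eq_zero p ?_
  rw [h]
  rw [kos₂_mulVec] at h
  have e0 := congrFun h 0
  have e1 := congrFun h 1
  have e2 := congrFun h 2
  have e3 := congrFun h 3
  simp [quadLead, harm₁, kappaLead] at e0 e1 e2 e3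
  -- setting `ξ_1^+` or `ξ_1^-` to zero isolates all the coefficients but `B`
  have hP₁0 : P₁ = 0 := by simpa [hP₁, y₂_ne] using congrArg killX e0
  have hP₂0 : P₂ = 0 := by simpa [hP₂, y₂_ne] using congrArg killX e2
  have hQ₁0 : Q₁ = 0 := by simpa [hQ₁, x₂_ne] using congrArg killY e0
  have hQ₂0 : Q₂ = 0 := by simpa [hQ₂, x₂_ne] using congrArg killY e1
  subst hP₁0 hP₂0 hQ₁0 hQ₂0
  -- `B` and `-B` are both the part of `p 2` independent of `ξ_1`
  have hB0 : B = 0 := by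
    obtain ⟨w, -, hw⟩ := y_syzygy (u := x₂ * p 1) (v := x₁ * p 0 + x₂ * (p 2 - B))
      (by linear_combination -e0)
    obtain ⟨w', hw', -⟩ := y_syzygy (u := x₁ * (p 2 + B) + x₂ * p 5) (v := x₁ * p 4)
      (by linear_combination e3)
    have h1 := congrArg killY hw
    have h2 := congrArg killY hw'
    simp only [map_add, map_sub, map_mul, map_neg, killY_x₁, killY_x₂, killY_y₁, killY_y₂, hBy,
      zero_mul, neg_zero] at h1 h2
    obtain ⟨v, -, hv⟩ := x_syzygy h1
    obtain ⟨v', hv', -⟩ := x_syzygy h2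
    have h3 := congrArg killX hv
    have h4 := congrArg killX hv'
    simp only [map_add, map_sub, map_mul, map_neg, killX_x₁, killX_x₂, hBx, zero_mul,
      neg_zero] at h3 h4
    have h5 : 2 * B = 0 := by linear_combination h4 - h3
    exact (mul_eq_zero.1 h5).resolve_left two_ne_zero
  subst hB0
  ext i; fin_cases i <;> simp [harm₁]

/-- The third syzygies of the leading quadrics. -/
lemma lead_three (p : Fin 4 → SusyPoly 2) (hp : kos₃ quadLead *ᵥ p ∈ Harm₂) :
    ∃ η, p = kos₄ quadLead *ᵥ η := by
  obtain ⟨P, Q, hP, hQ, h⟩ := hp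
  rw [kos₃_mulVec] at h
  have e0 := congrFun h 0
  have e1 := congrFun h 1
  have e3 := congrFun h 3
  simp [quadLead, harm₂] at e0 e1 e3
  have hP0 : P = 0 := by simpa [hP, y₂_ne] using congrArg killX e1
  have hQ0 : Q = 0 := by simpa [hQ, x₂_ne] using congrArg killY e0
  subst hP0 hQ0
  obtain ⟨w, hw, hw'⟩ := x_syzygy (u := y₁ * p 0) (v := y₂ * p 3)
    (by linear_combination e3)
  obtain ⟨w', hp0, hw₁⟩ := X_syzygy (i := (0, 1)) (j := (0, 3)) (by decide) (u := p 0) (v := -w)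
    (by change y₁ * _ + x₂ * _ = 0; linear_combination hw)
  change p 0 = x₂ * w' at hp0
  change -w = -(y₁ * w') at hw₁
  obtain ⟨s, hp3, hs⟩ := X_syzygy (i := (0, 2)) (j := (0, 1)) (by decide) (u := p 3)
    (v := x₁ * w') (by change y₂ * _ + y₁ * _ = 0; linear_combination hw' + x₁ * hw₁)
  change p 3 = y₁ * s at hp3
  change x₁ * w' = -(y₂ * s) at hs
  obtain ⟨r, hw₂, hs₂⟩ := X_syzygy (i := (0, 0)) (j := (0, 2)) (by decide) (u := w')
    (v := s) (by change x₁ * _ + y₂ * _ = 0; linear_combination hs)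
  change w' = y₂ * r at hw₂
  change s = -(x₁ * r) at hs₂
  refine ⟨![-r], ?_⟩
  rw [kos₄_mulVec]
  ext1 i
  fin_cases i <;> simp [quadLead]
  · rw [hp0, hw₂]; ring
  · refine mul_left_cancel₀ (mul_ne_zero x₂_ne y₂_ne) ?_
    rw [hp0, hw₂] at e0
    linear_combination e0
  · refine mul_left_cancel₀ (mul_ne_zero x₂_ne y₂_ne) ?_
    rw [hp0, hw₂] at e1
    linear_combination e1
  · rw [hp3, hs₂]; ring

/-! ### Homology of the full Koszul complex -/

lemma isHom_quadLead (e : Fin 4) : IsHom 2 (quadLead e) := by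
  fin_cases e
  · simpa [quadLead] using isHom_x₁.mul isHom_y₁
  · simpa [quadLead] using isHom_x₁.mul isHom_y₂
  · simpa [quadLead] using isHom_x₂.mul isHom_y₁
  · simpa [quadLead] using isHom_x₂.mul isHom_y₂

lemma isHom_quadTwo (e : Fin 4) : IsHom 0 (quadTwo e) := by
  fin_cases e
  · simpa [quadTwo] using isHom_a₁.mul isHom_d₁
  · simpa [quadTwo] using isHom_a₁.mul isHom_d₂
  · simpa [quadTwo] using isHom_a₂.mul isHom_d₁
  · simpa [quadTwo] using isHom_a₂.mul isHom_d₂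

section

variable {k : ℕ} {q : Fin 4 → SusyPoly 2}

lemma isHom_kos₁ (hq : ∀ e, IsHom k (q e)) (i j) : IsHom k (kos₁ q i j) := by
  fin_cases i; fin_cases j <;> simp [kos₁, hq]
lemma isHom_kos₂ (hq : ∀ e, IsHom k (q e)) (i j) : IsHom k (kos₂ q i j) := by
  fin_cases i <;> fin_cases j <;> simp [kos₂, hq, isHom_zero, IsHom.neg]
lemma isHom_kos₃ (hq : ∀ e, IsHom k (q e)) (i j) : IsHom k (kos₃ q i j) := by
  fin_cases i <;> fin_cases j <;> simp [kos₃, hq, isHom_zero, IsHom.neg]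
lemma isHom_kos₄ (hq : ∀ e, IsHom k (q e)) (i j) : IsHom k (kos₄ q i j) := by
  fin_cases i <;> fin_cases j <;> simp [kos₄, hq, IsHom.neg]

end

/-- A polynomial in `ξ_2` alone has degree zero in `ξ_1`. -/
lemma isHom_of_kill {p : SusyPoly 2} (hx : killX p = p) (hy : killY p = p) : IsHom 0 p := by
  have h : (scale.comp (killX.comp killY)) =
      ((Polynomial.CAlgHom (R := ℂ) (A := SusyPoly 2))).comp (killX.comp killY) := by
    apply MvPolynomial.algHom_ext
    rintro ⟨i, α⟩
    fin_cases i <;> fin_cases α <;> simp [killX, killY, scale]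
  have h' := DFunLike.congr_fun h p
  simp only [AlgHom.comp_apply, hy, hx] at h'
  constructor
  rw [h', pow_zero, one_mul]
  rfl

lemma compV_mem_Harm₀ (n : ℕ) {h : Fin 1 → SusyPoly 2} (hh : h ∈ Harm₀) : compV n h ∈ Harm₀ := by
  obtain ⟨P, Q, hP, hQ, rfl⟩ := hh
  refine ⟨comp n P, comp n Q, by rw [← comp_killX, hP], by rw [← comp_killY, hQ], ?_⟩
  ext1 i; fin_cases i; simp [compV]

lemma compV_mem_Harm₂ (n : ℕ) {h : Fin 6 → SusyPoly 2} (hh : h ∈ Harm₂) : compV n h ∈ Harm₂ := by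
  obtain ⟨P, Q, hP, hQ, rfl⟩ := hh
  have hxx : ∀ {f g : SusyPoly 2}, IsHom 1 f → IsHom 1 g → IsHom 2 (f * g) :=
    fun hf hg => hf.mul hg
  by_cases hn : n < 2
  · refine ⟨0, 0, by simp, by simp, ?_⟩
    ext1 i
    fin_cases i <;>
      simp [compV, harm₂, comp_mul_of_lt (hxx isHom_x₁ isHom_x₁) hn,
        comp_mul_of_lt (hxx isHom_x₂ isHom_x₂) hn, comp_mul_of_lt (hxx isHom_x₁ isHom_x₂) hn,
        comp_mul_of_lt (hxx isHom_y₁ isHom_y₁) hn, comp_mul_of_lt (hxx isHom_y₂ isHom_y₂) hn,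
        comp_mul_of_lt (hxx isHom_y₁ isHom_y₂) hn]
  · obtain ⟨m, rfl⟩ := Nat.exists_eq_add_of_le' (not_lt.1 hn)
    refine ⟨comp m P, comp m Q, by rw [← comp_killX, hP], by rw [← comp_killY, hQ], ?_⟩
    ext1 i
    fin_cases i <;>
      simp [compV, harm₂, comp_mul (hxx isHom_x₁ isHom_x₁),
        comp_mul (hxx isHom_x₂ isHom_x₂), comp_mul (hxx isHom_x₁ isHom_x₂),
        comp_mul (hxx isHom_y₁ isHom_y₁), comp_mul (hxx isHom_y₂ isHom_y₂),
        comp_mul (hxx isHom_y₁ isHom_y₂)]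

/-- Homogeneous parts of a harmonic one-form; the last coefficient has degree zero. -/
lemma compV_harm₁_succ (n : ℕ) (P₁ P₂ Q₁ Q₂ : SusyPoly 2) {B : SusyPoly 2} (hB : IsHom 0 B) :
    compV (n + 1) (harm₁ kappa P₁ P₂ Q₁ Q₂ B) =
      harm₁ kappaLead (comp n P₁) (comp n P₂) (comp n Q₁) (comp n Q₂) (if n = 1 then B else 0) ∧
    compV (n + 1) (harm₁ kappaLead P₁ P₂ Q₁ Q₂ B) =
      harm₁ kappaLead (comp n P₁) (comp n P₂) (comp n Q₁) (comp n Q₂) (if n = 1 then B else 0) := by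
  have e1 : ∀ {f g : SusyPoly 2}, IsHom 1 f → IsHom 1 g →
      comp (n + 1) (f * g * B) = f * g * (if n = 1 then B else 0) := fun hf hg => by
    rw [((hf.mul hg).mul hB).comp_eq]
    by_cases h : n = 1
    · rw [if_pos (by omega), if_pos h]
    · rw [if_neg (by omega), if_neg h, mul_zero]
  have e2 : ∀ {f g : SusyPoly 2}, IsHom 0 f → IsHom 0 g → comp (n + 1) (f * g * B) = 0 :=
    fun hf hg => by rw [((hf.mul hg).mul hB).comp_eq, if_neg (by omega)]
  constructor <;> ext1 i <;> fin_cases i <;>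
    simp [compV, harm₁, kappa, kappaLead, add_mul, sub_mul, comp_mul isHom_x₁, comp_mul isHom_x₂,
      comp_mul isHom_y₁, comp_mul isHom_y₂, -mul_ite, e1 isHom_x₁ isHom_y₁, e1 isHom_x₁ isHom_y₂,
      e1 isHom_x₂ isHom_y₁, e1 isHom_x₂ isHom_y₂, e2 isHom_a₁ isHom_d₁, e2 isHom_a₁ isHom_d₂,
      e2 isHom_a₂ isHom_d₁, e2 isHom_a₂ isHom_d₂]

lemma compV_harm₁_zero (P₁ P₂ Q₁ Q₂ : SusyPoly 2) {B : SusyPoly 2} (hB : IsHom 0 B) :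
    compV 0 (harm₁ kappaLead P₁ P₂ Q₁ Q₂ B) = 0 := by
  have e1 : ∀ {f g : SusyPoly 2}, IsHom 1 f → IsHom 1 g → comp 0 (f * g * B) = 0 :=
    fun hf hg => by rw [((hf.mul hg).mul hB).comp_eq, if_neg (by omega)]
  ext1 i; fin_cases i <;>
    simp [compV, harm₁, kappaLead, comp_mul_of_lt isHom_x₁, comp_mul_of_lt isHom_x₂,
      comp_mul_of_lt isHom_y₁, comp_mul_of_lt isHom_y₂, e1 isHom_x₁ isHom_y₁,
      e1 isHom_x₁ isHom_y₂, e1 isHom_x₂ isHom_y₁, e1 isHom_x₂ isHom_y₂]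

/-- The determinant `y₂ d₁ - y₁ d₂`, a multiple of `ξ_1^- · ξ_2^-`. -/
noncomputable def detMinus : SusyPoly 2 := y₂ * d₁ - y₁ * d₂

/-- The determinant `x₂ a₁ - x₁ a₂`, a multiple of `ξ_1^+ · ξ_2^+`. -/
noncomputable def detPlus : SusyPoly 2 := x₂ * a₁ - x₁ * a₂

@[simp] lemma killX_detMinus : killX detMinus = detMinus := by simp [detMinus]
@[simp] lemma killY_detMinus : killY detMinus = 0 := by simp [detMinus]
@[simp] lemma killY_detPlus : killY detPlus = detPlus := by simp [detPlus]
@[simp] lemma killX_detPlus : killX detPlus = 0 := by simp [detPlus]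

lemma detMinus_ne : detMinus ≠ 0 := fun h => by
  have h' : y₂ * d₁ + y₁ * (-d₂) = 0 := by rw [← h, detMinus]; ring
  obtain ⟨w, hw, -⟩ := X_syzygy (i := (0, 2)) (j := (0, 1)) (by decide) h'
  have := congrArg killY hw
  change killY d₁ = killY (y₁ * w) at this
  simp [d₁_ne] at this

lemma detPlus_ne : detPlus ≠ 0 := fun h => by
  have h' : x₂ * a₁ + x₁ * (-a₂) = 0 := by rw [← h, detPlus]; ring
  obtain ⟨w, hw, -⟩ := X_syzygy (i := (0, 3)) (j := (0, 0)) (by decide) h'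
  have := congrArg killX hw
  change killX a₁ = killX (x₁ * w) at this
  simp [a₁_ne] at this

/-- The Koszul differential on harmonic one-forms. -/
lemma kos₁_harm₁ (P₁ P₂ Q₁ Q₂ B : SusyPoly 2) : kos₁ quad *ᵥ harm₁ kappa P₁ P₂ Q₁ Q₂ B =
    ![detMinus * (a₁ * P₁ + a₂ * P₂) + detPlus * (d₁ * Q₁ + d₂ * Q₂)] := by
  rw [kos₁_mulVec]
  ext1 i; fin_cases i
  simp [quad, quadLead, quadTwo, harm₁, kappa, detMinus, detPlus]
  ring

/-- The Koszul differential on harmonic two-forms. -/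
lemma kos₂_harm₂ (P Q : SusyPoly 2) : kos₂ quad *ᵥ harm₂ P Q =
    harm₁ kappa (-(a₂ * (detMinus * P))) (a₁ * (detMinus * P)) (-(d₂ * (detPlus * Q)))
      (d₁ * (detPlus * Q)) 0 := by
  rw [kos₂_mulVec]
  ext1 i
  fin_cases i <;> simp [quad, quadLead, quadTwo, harm₁, harm₂, detMinus, detPlus] <;> ring

lemma harm₁_add (k : Fin 4 → SusyPoly 2) (P₁ P₂ Q₁ Q₂ B P₁' P₂' Q₁' Q₂' B' : SusyPoly 2) :
    harm₁ k P₁ P₂ Q₁ Q₂ B + harm₁ k P₁' P₂' Q₁' Q₂' B' =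
      harm₁ k (P₁ + P₁') (P₂ + P₂') (Q₁ + Q₁') (Q₂ + Q₂') (B + B') := by
  ext1 i; fin_cases i <;> simp [harm₁] <;> ring
lemma harm₁_sub (k : Fin 4 → SusyPoly 2) (P₁ P₂ Q₁ Q₂ B P₁' P₂' Q₁' Q₂' B' : SusyPoly 2) :
    harm₁ k P₁ P₂ Q₁ Q₂ B - harm₁ k P₁' P₂' Q₁' Q₂' B' =
      harm₁ k (P₁ - P₁') (P₂ - P₂') (Q₁ - Q₁') (Q₂ - Q₂') (B - B') := by
  ext1 i; fin_cases i <;> simp [harm₁] <;> ring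
lemma harm₁_zero (k : Fin 4 → SusyPoly 2) : harm₁ k 0 0 0 0 0 = 0 := by
  ext1 i; fin_cases i <;> simp [harm₁]

lemma zero_mem_Harm₀ : 0 ∈ Harm₀ := ⟨0, 0, by simp, by simp, by ext1 i; fin_cases i; simp⟩
lemma add_mem_Harm₀ {h h' : Fin 1 → SusyPoly 2} (hh : h ∈ Harm₀) (hh' : h' ∈ Harm₀) :
    h + h' ∈ Harm₀ := by
  obtain ⟨P, Q, hP, hQ, rfl⟩ := hh
  obtain ⟨P', Q', hP', hQ', rfl⟩ := hh'
  exact ⟨P + P', Q + Q', by simp [hP, hP'], by simp [hQ, hQ'],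
    by ext1 i; fin_cases i; simp; ring⟩
lemma sub_mem_Harm₀ {h h' : Fin 1 → SusyPoly 2} (hh : h ∈ Harm₀) (hh' : h' ∈ Harm₀) :
    h - h' ∈ Harm₀ := by
  obtain ⟨P, Q, hP, hQ, rfl⟩ := hh
  obtain ⟨P', Q', hP', hQ', rfl⟩ := hh'
  exact ⟨P - P', Q - Q', by simp [hP, hP'], by simp [hQ, hQ'],
    by ext1 i; fin_cases i; simp; ring⟩
lemma zero_mem_Harm₁ (k : Fin 4 → SusyPoly 2) : 0 ∈ Harm₁ k :=
  ⟨0, 0, 0, 0, 0, by simp, by simp, by simp, by simp, by simp, by simp, (harm₁_zero k).symm⟩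
lemma add_mem_Harm₁ {k h h' : Fin 4 → SusyPoly 2} (hh : h ∈ Harm₁ k) (hh' : h' ∈ Harm₁ k) :
    h + h' ∈ Harm₁ k := by
  obtain ⟨P₁, P₂, Q₁, Q₂, B, h1, h2, h3, h4, h5, h6, rfl⟩ := hh
  obtain ⟨P₁', P₂', Q₁', Q₂', B', h1', h2', h3', h4', h5', h6', rfl⟩ := hh'
  exact ⟨_, _, _, _, _, by rw [map_add, h1, h1'], by rw [map_add, h2, h2'],
    by rw [map_add, h3, h3'], by rw [map_add, h4, h4'], by rw [map_add, h5, h5'],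
    by rw [map_add, h6, h6'], harm₁_add ..⟩
lemma sub_mem_Harm₁ {k h h' : Fin 4 → SusyPoly 2} (hh : h ∈ Harm₁ k) (hh' : h' ∈ Harm₁ k) :
    h - h' ∈ Harm₁ k := by
  obtain ⟨P₁, P₂, Q₁, Q₂, B, h1, h2, h3, h4, h5, h6, rfl⟩ := hh
  obtain ⟨P₁', P₂', Q₁', Q₂', B', h1', h2', h3', h4', h5', h6', rfl⟩ := hh'
  exact ⟨_, _, _, _, _, by rw [map_sub, h1, h1'], by rw [map_sub, h2, h2'],
    by rw [map_sub, h3, h3'], by rw [map_sub, h4, h4'], by rw [map_sub, h5, h5'],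
    by rw [map_sub, h6, h6'], harm₁_sub ..⟩
lemma zero_mem_Harm₂ : 0 ∈ Harm₂ :=
  ⟨0, 0, by simp, by simp, by ext1 i; fin_cases i <;> simp [harm₂]⟩
lemma add_mem_Harm₂ {h h' : Fin 6 → SusyPoly 2} (hh : h ∈ Harm₂) (hh' : h' ∈ Harm₂) :
    h + h' ∈ Harm₂ := by
  obtain ⟨P, Q, hP, hQ, rfl⟩ := hh
  obtain ⟨P', Q', hP', hQ', rfl⟩ := hh'
  exact ⟨P + P', Q + Q', by simp [hP, hP'], by simp [hQ, hQ'],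
    by ext1 i; fin_cases i <;> simp [harm₂] <;> ring⟩
lemma sub_mem_Harm₂ {h h' : Fin 6 → SusyPoly 2} (hh : h ∈ Harm₂) (hh' : h' ∈ Harm₂) :
    h - h' ∈ Harm₂ := by
  obtain ⟨P, Q, hP, hQ, rfl⟩ := hh
  obtain ⟨P', Q', hP', hQ', rfl⟩ := hh'
  exact ⟨P - P', Q - Q', by simp [hP, hP'], by simp [hQ, hQ'],
    by ext1 i; fin_cases i <;> simp [harm₂] <;> ring⟩

/-- Every zero-form is harmonic up to a boundary. -/
lemma koszul_zero (p : Fin 1 → SusyPoly 2) : ∃ h ∈ Harm₀, ∃ η, p = h + kos₁ quad *ᵥ η := by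
  have := exists_eq_add_of_leading (κ := Fin 0) 0 0 (kos₁ quadLead) (kos₁ quadTwo)
    (fun i => i.elim0) (fun i => i.elim0) (isHom_kos₁ isHom_quadLead) (isHom_kos₁ isHom_quadTwo)
    (by ext i; exact i.elim0) Set.univ Set.univ Harm₀ Harm₀
    (fun _ _ _ _ => trivial) zero_mem_Harm₀ (fun _ hh _ hh' => add_mem_Harm₀ hh hh')
    (fun _ _ => trivial) (fun _ _ _ => trivial)
    (fun g hg n => ⟨_, compV_mem_Harm₀ n hg, by rw [compV_compV, if_pos rfl],
      fun m hm => by rw [compV_compV, if_neg (by omega)]⟩)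
    (fun p _ => lead_zero p) p trivial
  rwa [← kos₁_add] at this

/-- One-forms with harmonic boundary are harmonic up to a boundary. -/
lemma koszul_one (p : Fin 4 → SusyPoly 2) (hp : kos₁ quad *ᵥ p ∈ Harm₀) :
    ∃ h ∈ Harm₁ kappa, ∃ η, p = h + kos₂ quad *ᵥ η := by
  rw [quad, kos₁_add] at hp
  have := exists_eq_add_of_leading (kos₁ quadLead) (kos₁ quadTwo) (kos₂ quadLead) (kos₂ quadTwo)
    (isHom_kos₁ isHom_quadLead) (isHom_kos₁ isHom_quadTwo)
    (isHom_kos₂ isHom_quadLead) (isHom_kos₂ isHom_quadTwo)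
    (by rw [← kos₁_add, ← kos₂_add]; exact kos₁_mul_kos₂ _) Harm₀ Harm₀ (Harm₁ kappa)
    (Harm₁ kappaLead)
    (fun _ hh _ hh' => sub_mem_Harm₀ hh hh') (zero_mem_Harm₁ _)
    (fun _ hh _ hh' => add_mem_Harm₁ hh hh')
    (by
      rintro h ⟨P₁, P₂, Q₁, Q₂, B, h1, h2, h3, h4, -, -, rfl⟩
      rw [← kos₁_add]
      exact ⟨_, _, by simp [h1, h2], by simp [h3, h4], kos₁_harm₁ ..⟩)
    (fun h hh n => compV_mem_Harm₀ _ hh)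
    (by
      rintro g ⟨P₁, P₂, Q₁, Q₂, B, h1, h2, h3, h4, h5, h6, rfl⟩ n
      have hB := isHom_of_kill h5 h6
      rcases n with _ | n
      · refine ⟨0, zero_mem_Harm₁ _, ?_, fun m _ => compV_zero m⟩
        rw [compV_harm₁_zero _ _ _ _ hB, compV_zero]
      have hB' : IsHom 0 (if n = 1 then B else 0) := by
        split_ifs
        · exact hB
        · exact isHom_zero 0
      refine ⟨_, ⟨comp n P₁, comp n P₂, comp n Q₁, comp n Q₂, if n = 1 then B else 0,
        by rw [← comp_killX, h1], by rw [← comp_killX, h2], by rw [← comp_killY, h3],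
        by rw [← comp_killY, h4], by split_ifs <;> simp [h5], by split_ifs <;> simp [h6], rfl⟩,
        ?_, fun m hm => ?_⟩
      · rw [(compV_harm₁_succ n _ _ _ _ hB').1, (compV_harm₁_succ n _ _ _ _ hB).2]
        by_cases hn : n = 1 <;> simp [hn, comp_comp]
      · obtain ⟨m, rfl⟩ := Nat.exists_eq_add_of_le' (show 1 ≤ m by omega)
        rw [(compV_harm₁_succ m _ _ _ _ hB').1]
        have hmn : m ≠ n := by omega
        have hB0 : (if m = 1 then (if n = 1 then B else 0) else 0) = 0 := by
          split_ifs <;> first | rfl | omega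
        simp only [comp_comp, if_neg hmn, hB0, harm₁_zero])
    lead_one p hp
  rwa [← kos₂_add] at this

/-- Two-forms with harmonic boundary are harmonic up to a boundary. -/
lemma koszul_two (p : Fin 6 → SusyPoly 2) (hp : kos₂ quad *ᵥ p ∈ Harm₁ kappa) :
    ∃ h ∈ Harm₂, ∃ η, p = h + kos₃ quad *ᵥ η := by
  rw [quad, kos₂_add] at hp
  have := exists_eq_add_of_leading (kos₂ quadLead) (kos₂ quadTwo) (kos₃ quadLead) (kos₃ quadTwo)
    (isHom_kos₂ isHom_quadLead) (isHom_kos₂ isHom_quadTwo)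
    (isHom_kos₃ isHom_quadLead) (isHom_kos₃ isHom_quadTwo)
    (by rw [← kos₂_add, ← kos₃_add]; exact kos₂_mul_kos₃ _) (Harm₁ kappa) (Harm₁ kappaLead)
    Harm₂ Harm₂
    (fun _ hh _ hh' => sub_mem_Harm₁ hh hh') zero_mem_Harm₂
    (fun _ hh _ hh' => add_mem_Harm₂ hh hh')
    (by
      rintro h ⟨P, Q, hP, hQ, rfl⟩
      rw [← kos₂_add]
      exact ⟨_, _, _, _, _, by simp [hP], by simp [hP], by simp [hQ], by simp [hQ], by simp,
        by simp, kos₂_harm₂ ..⟩)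
    (by
      rintro h ⟨P₁, P₂, Q₁, Q₂, B, h1, h2, h3, h4, h5, h6, rfl⟩ n
      rw [(compV_harm₁_succ (n + 1) _ _ _ _ (isHom_of_kill h5 h6)).1]
      exact ⟨_, _, _, _, _, by rw [← comp_killX, h1], by rw [← comp_killX, h2],
        by rw [← comp_killY, h3], by rw [← comp_killY, h4], by split_ifs <;> simp [h5],
        by split_ifs <;> simp [h6], rfl⟩)
    (fun g hg n => ⟨_, compV_mem_Harm₂ n hg, by rw [compV_compV, if_pos rfl],
      fun m hm => by rw [compV_compV, if_neg (by omega)]⟩)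
    lead_two p hp
  rwa [← kos₃_add] at this

/-- Three-forms with harmonic boundary are boundaries. -/
lemma koszul_three (p : Fin 4 → SusyPoly 2) (hp : kos₃ quad *ᵥ p ∈ Harm₂) :
    ∃ η, p = kos₄ quad *ᵥ η := by
  rw [quad, kos₃_add] at hp
  obtain ⟨h, hh, η, hη⟩ := exists_eq_add_of_leading (kos₃ quadLead) (kos₃ quadTwo)
    (kos₄ quadLead) (kos₄ quadTwo)
    (isHom_kos₃ isHom_quadLead) (isHom_kos₃ isHom_quadTwo)
    (isHom_kos₄ isHom_quadLead) (isHom_kos₄ isHom_quadTwo)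
    (by rw [← kos₃_add, ← kos₄_add]; exact kos₃_mul_kos₄ _) Harm₂ Harm₂ {0} {0}
    (fun _ hh _ hh' => sub_mem_Harm₂ hh hh') rfl
    (fun h hh h' hh' => by rw [Set.mem_singleton_iff] at *; rw [hh, hh', add_zero])
    (fun h hh => by
      rw [Set.mem_singleton_iff.1 hh, Matrix.mulVec_zero]; exact zero_mem_Harm₂)
    (fun h hh n => compV_mem_Harm₂ _ hh)
    (fun g hg n => ⟨0, rfl, by rw [Set.mem_singleton_iff.1 hg], fun m _ => compV_zero m⟩)
    (fun p hp => by
      obtain ⟨η, hη⟩ := lead_three p hp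
      exact ⟨0, rfl, η, by rw [zero_add, hη]⟩) p hp
  rw [Set.mem_singleton_iff.1 hh, ← kos₄_add, zero_add] at hη
  exact ⟨η, hη⟩

/-- There are no nonzero four-form cocycles. -/
lemma koszul_four (p : Fin 1 → SusyPoly 2) (hp : kos₄ quad *ᵥ p = 0) : p = 0 := by
  rw [kos₄_mulVec] at hp
  have h := congrFun hp 3
  have hq : quad 0 ≠ 0 := fun h => by
    have := congrArg killX h
    simp [quad, quadLead, quadTwo, a₁_ne, d₁_ne] at this
  ext1 i; fin_cases i
  exact (mul_eq_zero.1 h).resolve_left hq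

/-! ### The cohomology in form degrees zero and one -/

/-- The one-form `(a₂ ϑ_1 - a₁ ϑ_2) H + (d₂ ϑ'_1 - d₁ ϑ'_2) G + kappa B`. -/
noncomputable def reprOne (H G B : SusyPoly 2) : Fin 4 → SusyPoly 2 :=
  harm₁ kappa (a₂ * H) (-(a₁ * H)) (d₂ * G) (-(d₁ * G)) B

lemma kos₁_reprOne (H G B : SusyPoly 2) : kos₁ quad *ᵥ reprOne H G B = 0 := by
  rw [reprOne, kos₁_harm₁]; ext1 i; fin_cases i; simp; ring

/-- Cocycles of form degree one. -/
lemma exists_reprOne (p : Fin 4 → SusyPoly 2) (hp : kos₁ quad *ᵥ p = 0) :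
    ∃ H G B η, killX H = H ∧ killY G = G ∧ killX B = B ∧ killY B = B ∧
      p = reprOne H G B + kos₂ quad *ᵥ η := by
  obtain ⟨h, ⟨P₁, P₂, Q₁, Q₂, B, h1, h2, h3, h4, h5, h6, rfl⟩, η, rfl⟩ :=
    koszul_one p (by rw [hp]; exact zero_mem_Harm₀)
  rw [Matrix.mulVec_add, Matrix.mulVec_mulVec, kos₁_mul_kos₂, Matrix.zero_mulVec, add_zero,
    kos₁_harm₁] at hp
  have hp0 : detMinus * (a₁ * P₁ + a₂ * P₂) + detPlus * (d₁ * Q₁ + d₂ * Q₂) = 0 := congrFun hp 0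
  have hP : a₁ * P₁ + a₂ * P₂ = 0 := by
    simpa [detMinus_ne, h1, h2] using congrArg killX hp0
  have hQ : d₁ * Q₁ + d₂ * Q₂ = 0 := by
    simpa [detPlus_ne, h3, h4] using congrArg killY hp0
  obtain ⟨H, rfl, rfl⟩ := a_syzygy hP
  obtain ⟨G, rfl, rfl⟩ := d_syzygy hQ
  refine ⟨H, G, B, η, ?_, ?_, h5, h6, rfl⟩
  · exact mul_left_cancel₀ a₂_ne (by simpa using h1)
  · exact mul_left_cancel₀ d₂_ne (by simpa using h3)

/-- Coboundaries among the representatives of form degree one. -/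
lemma reprOne_eq_iff {H G B : SusyPoly 2} (hH : killX H = H) (hG : killY G = G)
    (hBx : killX B = B) (hBy : killY B = B) :
    (∃ η, reprOne H G B = kos₂ quad *ᵥ η) ↔
      (∃ P, killX P = P ∧ H = detMinus * P) ∧ (∃ Q, killY Q = Q ∧ G = detPlus * Q) ∧ B = 0 := by
  constructor
  · rintro ⟨η, hη⟩
    obtain ⟨h, ⟨P, Q, hP, hQ, rfl⟩, η', rfl⟩ := koszul_two η (by
      rw [← hη]
      exact ⟨_, _, _, _, _, by simp [hH], by simp [hH], by simp [hG], by simp [hG], hBx, hBy,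
        rfl⟩)
    rw [Matrix.mulVec_add, Matrix.mulVec_mulVec, kos₂_mul_kos₃, Matrix.zero_mulVec, add_zero,
      kos₂_harm₂, reprOne, ← sub_eq_zero, harm₁_sub] at hη
    have e0 := congrFun hη 0
    have e1 := congrFun hη 1
    simp [harm₁, kappa] at e0 e1
    -- the part of the first component that mixes `ξ_1^+` and `ξ_1^-` is `x₂ y₂ B`
    have hx := congrArg killX e0
    have hy := congrArg killY e0
    have hxy := congrArg killX hy
    simp [hH, hG, hBx, hBy, hP, hQ] at hx hy hxy
    have hB : B = 0 := hxy.resolve_left (not_or.2 ⟨a₂_ne, d₂_ne⟩)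
    subst hB
    refine ⟨⟨-P, by simp [hP], ?_⟩, ⟨-Q, by simp [hQ], ?_⟩, rfl⟩
    · refine mul_left_cancel₀ (mul_ne_zero y₂_ne a₂_ne) ?_
      linear_combination hx
    · refine mul_left_cancel₀ (mul_ne_zero x₂_ne d₂_ne) ?_
      linear_combination hy
  · rintro ⟨⟨P, -, rfl⟩, ⟨Q, -, rfl⟩, rfl⟩
    refine ⟨harm₂ (-P) (-Q), ?_⟩
    rw [kos₂_harm₂, reprOne]
    congr 1 <;> ring

/-- Coboundaries among the harmonic zero-forms. -/
lemma reprZero_eq_iff {P Q : SusyPoly 2} (hP : killX P = P) (hQ : killY Q = Q) :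
    (∃ η, ![P + Q] = kos₁ quad *ᵥ η) ↔
      ∃ P₁ P₂ Q₁ Q₂, killX P₁ = P₁ ∧ killX P₂ = P₂ ∧ killY Q₁ = Q₁ ∧ killY Q₂ = Q₂ ∧
        P + Q = detMinus * (a₁ * P₁ + a₂ * P₂) + detPlus * (d₁ * Q₁ + d₂ * Q₂) := by
  constructor
  · rintro ⟨η, hη⟩
    obtain ⟨h, ⟨P₁, P₂, Q₁, Q₂, B, h1, h2, h3, h4, -, -, rfl⟩, η', rfl⟩ :=
      koszul_one η (by rw [← hη]; exact ⟨P, Q, hP, hQ, rfl⟩)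
    rw [Matrix.mulVec_add, Matrix.mulVec_mulVec, kos₁_mul_kos₂, Matrix.zero_mulVec, add_zero,
      kos₁_harm₁] at hη
    exact ⟨P₁, P₂, Q₁, Q₂, h1, h2, h3, h4, congrFun hη 0⟩
  · rintro ⟨P₁, P₂, Q₁, Q₂, -, -, -, -, h⟩
    exact ⟨harm₁ kappa P₁ P₂ Q₁ Q₂ 0, by rw [kos₁_harm₁, h]⟩

/-! ### Components in the exterior algebra of a free module of rank four -/

section Exterior

variable {R : Type*} [CommRing R] (v : Fin 4 → (Fin 4 → R))

/-- The element of the exterior algebra with components `p₀, …, p₄` in form degrees zero to four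
with respect to the products of the vectors `v e`, in the order used for the Koszul complex. -/
noncomputable def forms (p₀ : Fin 1 → R) (p₁ : Fin 4 → R) (p₂ : Fin 6 → R) (p₃ : Fin 4 → R)
    (p₄ : Fin 1 → R) : ExteriorAlgebra R (Fin 4 → R) :=
  let c : Fin 4 → ExteriorAlgebra R (Fin 4 → R) := fun e => ExteriorAlgebra.ι R (v e)
  p₀ 0 • 1 + (p₁ 0 • c 0 + p₁ 1 • c 1 + p₁ 2 • c 2 + p₁ 3 • c 3) +
    (p₂ 0 • (c 0 * c 1) + p₂ 1 • (c 0 * c 2) + p₂ 2 • (c 0 * c 3) + p₂ 3 • (c 1 * c 2) +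
      p₂ 4 • (c 1 * c 3) + p₂ 5 • (c 2 * c 3)) +
    (p₃ 0 • (c 0 * (c 1 * c 2)) + p₃ 1 • (c 0 * (c 1 * c 3)) + p₃ 2 • (c 0 * (c 2 * c 3)) +
      p₃ 3 • (c 1 * (c 2 * c 3))) +
    p₄ 0 • (c 0 * (c 1 * (c 2 * c 3)))

lemma contractLeft_ι_mul' (φ : Module.Dual R (Fin 4 → R)) (m : Fin 4 → R)
    (w : ExteriorAlgebra R (Fin 4 → R)) :
    CliffordAlgebra.contractLeft (Q := (0 : QuadraticForm R (Fin 4 → R))) φ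
        (ExteriorAlgebra.ι R m * w) =
      φ m • w - ExteriorAlgebra.ι R m *
        CliffordAlgebra.contractLeft (Q := (0 : QuadraticForm R (Fin 4 → R))) φ w :=
  CliffordAlgebra.contractLeft_ι_mul _ _ _

lemma contractLeft_ι' (φ : Module.Dual R (Fin 4 → R)) (m : Fin 4 → R) :
    CliffordAlgebra.contractLeft (Q := (0 : QuadraticForm R (Fin 4 → R))) φ
        (ExteriorAlgebra.ι R m) = φ m • (1 : ExteriorAlgebra R (Fin 4 → R)) :=
  (CliffordAlgebra.contractLeft_ι _ φ m).trans (Algebra.algebraMap_eq_smul_one _)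

lemma contractLeft_one' (φ : Module.Dual R (Fin 4 → R)) :
    CliffordAlgebra.contractLeft (Q := (0 : QuadraticForm R (Fin 4 → R))) φ
        (1 : ExteriorAlgebra R (Fin 4 → R)) = 0 :=
  CliffordAlgebra.contractLeft_one _ φ

/-- Contraction with a linear form acts on components by the Koszul differentials. -/
lemma contractLeft_forms (φ : Module.Dual R (Fin 4 → R)) (p₀ : Fin 1 → R) (p₁ : Fin 4 → R)
    (p₂ : Fin 6 → R) (p₃ : Fin 4 → R) (p₄ : Fin 1 → R) :
    CliffordAlgebra.contractLeft (Q := (0 : QuadraticForm R (Fin 4 → R))) φ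
        (forms v p₀ p₁ p₂ p₃ p₄) =
      forms v (kos₁ (fun e => φ (v e)) *ᵥ p₁) (kos₂ (fun e => φ (v e)) *ᵥ p₂)
        (kos₃ (fun e => φ (v e)) *ᵥ p₃) (kos₄ (fun e => φ (v e)) *ᵥ p₄) 0 := by
  rw [kos₁_mulVec, kos₂_mulVec, kos₃_mulVec, kos₄_mulVec]
  simp only [forms, map_add, map_smul, contractLeft_ι_mul', contractLeft_ι', contractLeft_one',
    mul_sub, mul_smul_comm, mul_one, Matrix.cons_val, Pi.zero_apply]
  module

lemma forms_add (p₀ p₀' : Fin 1 → R) (p₁ p₁' : Fin 4 → R) (p₂ p₂' : Fin 6 → R)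
    (p₃ p₃' : Fin 4 → R) (p₄ p₄' : Fin 1 → R) :
    forms v p₀ p₁ p₂ p₃ p₄ + forms v p₀' p₁' p₂' p₃' p₄' =
      forms v (p₀ + p₀') (p₁ + p₁') (p₂ + p₂') (p₃ + p₃') (p₄ + p₄') := by
  simp only [forms, Pi.add_apply]
  module

lemma forms_sub (p₀ p₀' : Fin 1 → R) (p₁ p₁' : Fin 4 → R) (p₂ p₂' : Fin 6 → R)
    (p₃ p₃' : Fin 4 → R) (p₄ p₄' : Fin 1 → R) :
    forms v p₀ p₁ p₂ p₃ p₄ - forms v p₀' p₁' p₂' p₃' p₄' =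
      forms v (p₀ - p₀') (p₁ - p₁') (p₂ - p₂') (p₃ - p₃') (p₄ - p₄') := by
  simp only [forms, Pi.sub_apply]
  module

lemma ι_mul_forms (r : Fin 4 → R) (p₀ : Fin 1 → R) (p₁ : Fin 4 → R)
    (p₂ : Fin 6 → R) (p₃ : Fin 4 → R) (p₄ : Fin 1 → R) :
    ExteriorAlgebra.ι R (∑ e, r e • v e) * forms v p₀ p₁ p₂ p₃ p₄ =
      forms v 0 ![r 0 * p₀ 0, r 1 * p₀ 0, r 2 * p₀ 0, r 3 * p₀ 0]
        ![r 0 * p₁ 1 - r 1 * p₁ 0, r 0 * p₁ 2 - r 2 * p₁ 0, r 0 * p₁ 3 - r 3 * p₁ 0,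
          r 1 * p₁ 2 - r 2 * p₁ 1, r 1 * p₁ 3 - r 3 * p₁ 1, r 2 * p₁ 3 - r 3 * p₁ 2]
        ![r 0 * p₂ 3 - r 1 * p₂ 1 + r 2 * p₂ 0, r 0 * p₂ 4 - r 1 * p₂ 2 + r 3 * p₂ 0,
          r 0 * p₂ 5 - r 2 * p₂ 2 + r 3 * p₂ 1, r 1 * p₂ 5 - r 2 * p₂ 4 + r 3 * p₂ 3]
        ![r 0 * p₃ 3 - r 1 * p₃ 2 + r 2 * p₃ 1 - r 3 * p₃ 0] := by
  have sq : ∀ e, ExteriorAlgebra.ι R (v e) * ExteriorAlgebra.ι R (v e) = 0 :=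
    fun e => ExteriorAlgebra.ι_sq_zero _
  have sq' : ∀ e w, ExteriorAlgebra.ι R (v e) * (ExteriorAlgebra.ι R (v e) * w) = 0 :=
    fun e w => by rw [← mul_assoc, sq, zero_mul]
  have sw : ∀ e f, ExteriorAlgebra.ι R (v f) * ExteriorAlgebra.ι R (v e) =
      -(ExteriorAlgebra.ι R (v e) * ExteriorAlgebra.ι R (v f)) := fun e f =>
    eq_neg_of_add_eq_zero_left (ExteriorAlgebra.ι_add_mul_swap _ _)
  have sw' : ∀ e f w, ExteriorAlgebra.ι R (v f) * (ExteriorAlgebra.ι R (v e) * w) =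
      -(ExteriorAlgebra.ι R (v e) * (ExteriorAlgebra.ι R (v f) * w)) := fun e f w => by
    rw [← mul_assoc, sw, neg_mul, mul_assoc]
  simp only [forms, map_add, map_smul, Fin.sum_univ_four, add_mul, mul_add, mul_smul_comm,
    smul_mul_assoc, mul_one, sq, sq', sw 0 1, sw 0 2, sw 0 3, sw 1 2, sw 1 3, sw 2 3, sw' 0 1,
    sw' 0 2, sw' 0 3, sw' 1 2, sw' 1 3, sw' 2 3, mul_neg, neg_neg, mul_zero, smul_zero, neg_zero,
    Matrix.cons_val, Pi.zero_apply]
  module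

variable {v}

/-- If the `v e` span, every element of the exterior algebra has components. -/
lemma exists_forms (hv : ∀ m : Fin 4 → R, ∃ r : Fin 4 → R, m = ∑ e, r e • v e)
    (ω : ExteriorAlgebra R (Fin 4 → R)) : ∃ p₀ p₁ p₂ p₃ p₄, ω = forms v p₀ p₁ p₂ p₃ p₄ := by
  induction ω using CliffordAlgebra.left_induction with
  | algebraMap r =>
    refine ⟨![r], 0, 0, 0, 0, ?_⟩
    simp only [forms, Pi.zero_apply, Matrix.cons_val, zero_smul, add_zero]
    exact Algebra.algebraMap_eq_smul_one r
  | add x y hx hy =>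
    obtain ⟨p₀, p₁, p₂, p₃, p₄, rfl⟩ := hx
    obtain ⟨p₀', p₁', p₂', p₃', p₄', rfl⟩ := hy
    exact ⟨_, _, _, _, _, forms_add v ..⟩
  | ι_mul x m hx =>
    obtain ⟨p₀, p₁, p₂, p₃, p₄, rfl⟩ := hx
    obtain ⟨r, rfl⟩ := hv m
    exact ⟨_, _, _, _, _, ι_mul_forms v ..⟩

lemma eq_zero_of_forms_eq_zero₀ {p₀ : Fin 1 → R} {p₁ : Fin 4 → R} {p₂ : Fin 6 → R}
    {p₃ : Fin 4 → R} {p₄ : Fin 1 → R} (h : forms v p₀ p₁ p₂ p₃ p₄ = 0) : p₀ = 0 := by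
  have h' := congrArg (ExteriorAlgebra.algebraMapInv (R := R) (M := Fin 4 → R)) h
  have hι : ∀ m, ExteriorAlgebra.algebraMapInv (ExteriorAlgebra.ι R (M := Fin 4 → R) m) = 0 :=
    fun m => by simp [ExteriorAlgebra.algebraMapInv]
  simp [forms, hι] at h'
  ext1 i; fin_cases i; exact h'

/-- If the `v e` are linearly independent with dual linear forms, components are unique:
contracting with the dual forms lowers the form degree. -/
lemma eq_zero_of_forms_eq_zero
    (hv : ∀ e, ∃ φ : Module.Dual R (Fin 4 → R), ∀ f, φ (v f) = if f = e then 1 else 0)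
    {p₀ : Fin 1 → R} {p₁ : Fin 4 → R} {p₂ : Fin 6 → R} {p₃ : Fin 4 → R} {p₄ : Fin 1 → R}
    (h : forms v p₀ p₁ p₂ p₃ p₄ = 0) : p₀ = 0 ∧ p₁ = 0 ∧ p₂ = 0 ∧ p₃ = 0 ∧ p₄ = 0 := by
  choose φ hφ using hv
  have hc : ∀ {p₀ : Fin 1 → R} {p₁ : Fin 4 → R} {p₂ : Fin 6 → R} {p₃ : Fin 4 → R}
      {p₄ : Fin 1 → R}, forms v p₀ p₁ p₂ p₃ p₄ = 0 → ∀ e,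
      forms v (kos₁ (fun f => φ e (v f)) *ᵥ p₁) (kos₂ (fun f => φ e (v f)) *ᵥ p₂)
        (kos₃ (fun f => φ e (v f)) *ᵥ p₃) (kos₄ (fun f => φ e (v f)) *ᵥ p₄) 0 = 0 := by
    intro p₀ p₁ p₂ p₃ p₄ h e
    rw [← contractLeft_forms, h, map_zero]
  have h₁ : ∀ {p₀ : Fin 1 → R} {p₁ : Fin 4 → R} {p₂ : Fin 6 → R} {p₃ : Fin 4 → R}
      {p₄ : Fin 1 → R}, forms v p₀ p₁ p₂ p₃ p₄ = 0 → p₁ = 0 := by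
    intro p₀ p₁ p₂ p₃ p₄ h
    ext1 e
    have := congrFun (eq_zero_of_forms_eq_zero₀ (hc h e)) 0
    rw [kos₁_mulVec] at this
    fin_cases e <;> simpa [hφ] using this
  have h₂ : ∀ {p₀ : Fin 1 → R} {p₁ : Fin 4 → R} {p₂ : Fin 6 → R} {p₃ : Fin 4 → R}
      {p₄ : Fin 1 → R}, forms v p₀ p₁ p₂ p₃ p₄ = 0 → p₂ = 0 := by
    intro p₀ p₁ p₂ p₃ p₄ h
    have h0 := h₁ (hc h 0)
    have h1 := h₁ (hc h 1)
    have h2 := h₁ (hc h 2)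
    rw [kos₂_mulVec] at h0 h1 h2
    ext1 i
    fin_cases i
    · simpa [hφ] using congrFun h0 1
    · simpa [hφ] using congrFun h0 2
    · simpa [hφ] using congrFun h0 3
    · simpa [hφ] using congrFun h1 2
    · simpa [hφ] using congrFun h1 3
    · simpa [hφ] using congrFun h2 3
  have h₃ : ∀ {p₀ : Fin 1 → R} {p₁ : Fin 4 → R} {p₂ : Fin 6 → R} {p₃ : Fin 4 → R}
      {p₄ : Fin 1 → R}, forms v p₀ p₁ p₂ p₃ p₄ = 0 → p₃ = 0 := by
    intro p₀ p₁ p₂ p₃ p₄ h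
    have h0 := h₂ (hc h 0)
    have h1 := h₂ (hc h 1)
    rw [kos₃_mulVec] at h0 h1
    ext1 i
    fin_cases i
    · simpa [hφ] using congrFun h0 3
    · simpa [hφ] using congrFun h0 4
    · simpa [hφ] using congrFun h0 5
    · simpa [hφ] using congrFun h1 5
  refine ⟨eq_zero_of_forms_eq_zero₀ h, h₁ h, h₂ h, h₃ h, ?_⟩
  have h0 := h₃ (hc h 0)
  rw [kos₄_mulVec] at h0
  ext1 i
  fin_cases i
  simpa [hφ] using congrFun h0 3

end Exterior

/-! ### The particular representation -/

lemma tensor_eq (A B : Matrix (Fin 2) (Fin 2) ℂ) : tensor A B =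
    !![A 0 0 * B 0 0, A 0 0 * B 0 1, A 0 1 * B 0 0, A 0 1 * B 0 1;
       A 0 0 * B 1 0, A 0 0 * B 1 1, A 0 1 * B 1 0, A 0 1 * B 1 1;
       A 1 0 * B 0 0, A 1 0 * B 0 1, A 1 1 * B 0 0, A 1 1 * B 0 1;
       A 1 0 * B 1 0, A 1 0 * B 1 1, A 1 1 * B 1 0, A 1 1 * B 1 1] := by
  ext i j; fin_cases i <;> fin_cases j <;> rfl

lemma particularRep_chargeConj (t : ℕ) : (particularRep t).chargeConj =
    !![0, 0, 0, -Complex.I; 0, 0, -Complex.I, 0; 0, Complex.I, 0, 0; Complex.I, 0, 0, 0] := by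
  ext i j; fin_cases i <;> fin_cases j <;> simp [particularRep, tensor_eq, pauli]

lemma particularRep_chir (t : ℕ) : (particularRep t).chir =
    !![1, 0, 0, 0; 0, -1, 0, 0; 0, 0, -1, 0; 0, 0, 0, 1] := by
  ext i j; fin_cases i <;> fin_cases j <;> simp [particularRep, tensor_eq, pauli]

lemma particularRep_gam_zero (t : ℕ) : (particularRep t).gam 0 =
    kFactor t 0 • !![0, 0, 1, 0; 0, 0, 0, 1; 1, 0, 0, 0; 0, 1, 0, 0] := by
  ext i j; fin_cases i <;> fin_cases j <;> simp [particularRep, tensor_eq, pauli]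
lemma particularRep_gam_one (t : ℕ) : (particularRep t).gam 1 = kFactor t 1 •
    !![0, 0, -Complex.I, 0; 0, 0, 0, -Complex.I; Complex.I, 0, 0, 0; 0, Complex.I, 0, 0] := by
  ext i j; fin_cases i <;> fin_cases j <;> simp [particularRep, tensor_eq, pauli]
lemma particularRep_gam_two (t : ℕ) : (particularRep t).gam 2 =
    kFactor t 2 • !![0, 1, 0, 0; 1, 0, 0, 0; 0, 0, 0, -1; 0, 0, -1, 0] := by
  ext i j; fin_cases i <;> fin_cases j <;> simp [particularRep, tensor_eq, pauli]
lemma particularRep_gam_three (t : ℕ) : (particularRep t).gam 3 = kFactor t 3 •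
    !![0, -Complex.I, 0, 0; Complex.I, 0, 0, 0; 0, 0, 0, Complex.I; 0, 0, -Complex.I, 0] := by
  ext i j; fin_cases i <;> fin_cases j <;> simp [particularRep, tensor_eq, pauli]

lemma particularRep_chargeConj_mul_self (t : ℕ) :
    (particularRep t).chargeConj * (particularRep t).chargeConj = 1 := by
  rw [particularRep_chargeConj]
  ext i j; fin_cases i <;> fin_cases j <;> simp [Matrix.mul_apply, Fin.sum_univ_four]

lemma particularRep_chargeConj_inv (t : ℕ) :
    (particularRep t).chargeConj⁻¹ = (particularRep t).chargeConj :=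
  Matrix.inv_eq_left_inv (particularRep_chargeConj_mul_self t)

lemma metricSign_mul_kFactor (t : ℕ) (a : Fin 4) :
    metricSign t a * kFactor t a * kFactor t a = 1 := by
  unfold metricSign kFactor
  split_ifs <;> simp

/-! ### Linear changes of the spinor basis -/

/-- The row vector `u M`. -/
noncomputable def rowMul (M : Matrix (Fin 4) (Fin 4) ℂ) (u : Fin 4 → SusyPoly 2) :
    Fin 4 → SusyPoly 2 := u ᵥ* M.map C

/-- The bilinear form `u M wᵀ`. -/
noncomputable def bil (M : Matrix (Fin 4) (Fin 4) ℂ) (u w : Fin 4 → SusyPoly 2) : SusyPoly 2 :=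
  u ⬝ᵥ (M.map C *ᵥ w)

lemma rowMul_apply (M : Matrix (Fin 4) (Fin 4) ℂ) (u : Fin 4 → SusyPoly 2) (β : Fin 4) :
    rowMul M u β = ∑ α, C (M α β) * u α := by
  simp [rowMul, Matrix.vecMul, dotProduct, mul_comm]

lemma bil_eq (M : Matrix (Fin 4) (Fin 4) ℂ) (u w : Fin 4 → SusyPoly 2) :
    bil M u w = ∑ α, ∑ β, C (M α β) * (u α * w β) := by
  simp only [bil, Matrix.mulVec, dotProduct, Finset.mul_sum, Matrix.map_apply]
  exact Finset.sum_congr rfl fun α _ => Finset.sum_congr rfl fun β _ => by ring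

lemma rowMul_rowMul (A B : Matrix (Fin 4) (Fin 4) ℂ) (u : Fin 4 → SusyPoly 2) :
    rowMul B (rowMul A u) = rowMul (A * B) u := by
  simp [rowMul, Matrix.vecMul_vecMul, Matrix.map_mul]

lemma rowMul_one (u : Fin 4 → SusyPoly 2) : rowMul 1 u = u := by
  ext1 β
  simp [rowMul_apply, Matrix.one_apply]

lemma bil_rowMul (A B M : Matrix (Fin 4) (Fin 4) ℂ) (u w : Fin 4 → SusyPoly 2) :
    bil M (rowMul A u) (rowMul B w) = bil (A * M * Bᵀ) u w := by
  simp only [bil, rowMul, Matrix.map_mul, ← Matrix.mulVec_mulVec, Matrix.dotProduct_mulVec,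
    ← Matrix.mulVec_transpose]
  rw [← Matrix.transpose_map]

/-- The substitution `ξ_i ↦ ξ_i T`. -/
noncomputable def rot (T : Matrix (Fin 4) (Fin 4) ℂ) : SusyPoly 2 →ₐ[ℂ] SusyPoly 2 :=
  aeval fun v => rowMul T (xi v.1) v.2

lemma rot_xi (T : Matrix (Fin 4) (Fin 4) ℂ) (i : Fin 2) (α : Fin 4) :
    rot T (xi i α) = rowMul T (xi i) α := by
  rw [rot, xi, aeval_X]

lemma rot_comp (T T' : Matrix (Fin 4) (Fin 4) ℂ) : (rot T).comp (rot T') = rot (T * T') := by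
  apply MvPolynomial.algHom_ext
  rintro ⟨i, α⟩
  change rot T (rot T' (xi i α)) = rot (T * T') (xi i α)
  rw [rot_xi, rot_xi, ← rowMul_rowMul, rowMul_apply, rowMul_apply, map_sum]
  refine Finset.sum_congr rfl fun β _ => ?_
  rw [map_mul, rot_xi]
  congr 1
  exact (rot T).commutes _

lemma rot_one : rot 1 = AlgHom.id ℂ (SusyPoly 2) := by
  apply MvPolynomial.algHom_ext
  rintro ⟨i, α⟩
  change rot 1 (xi i α) = xi i α
  rw [rot_xi, rowMul_one]

/-- The automorphism `ξ_i ↦ ξ_i T` of the ring of ghost polynomials. -/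
noncomputable def rotEquiv (T : GL (Fin 4) ℂ) : SusyPoly 2 ≃ₐ[ℂ] SusyPoly 2 :=
  AlgEquiv.ofAlgHom (rot T.1) (rot (T.1)⁻¹)
    (by rw [rot_comp, Matrix.mul_nonsing_inv _ ((Matrix.isUnit_iff_isUnit_det _).1 T.isUnit), rot_one])
    (by rw [rot_comp, Matrix.nonsing_inv_mul _ ((Matrix.isUnit_iff_isUnit_det _).1 T.isUnit), rot_one])

lemma rotEquiv_xi (T : GL (Fin 4) ℂ) (i : Fin 2) (α : Fin 4) :
    rotEquiv T (xi i α) = rowMul T.1 (xi i) α := rot_xi _ _ _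

lemma rotEquiv_C (T : GL (Fin 4) ℂ) (r : ℂ) : rotEquiv T (C r) = C r := (rotEquiv T).commutes r

section ChangeBasis

variable (t : ℕ) (T : GL (Fin 4) ℂ)

lemma isUnit_det : IsUnit (T.1 : Matrix (Fin 4) (Fin 4) ℂ).det :=
  (Matrix.isUnit_iff_isUnit_det _).1 T.isUnit

lemma mul_inv_T : (T.1 : Matrix (Fin 4) (Fin 4) ℂ) * (T.1)⁻¹ = 1 :=
  Matrix.mul_nonsing_inv _ (isUnit_det T)
lemma inv_mul_T : (T.1 : Matrix (Fin 4) (Fin 4) ℂ)⁻¹ * T.1 = 1 :=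
  Matrix.nonsing_inv_mul _ (isUnit_det T)

/-- The spinors `ξ_i T`, in which the changed representation takes its particular form. -/
noncomputable def newXi (i : Fin 2) : Fin 4 → SusyPoly 2 := rowMul T.1 (xi i)

variable (S₀ : SpinorRep)

lemma changeBasis_chargeConj_inv :
    (S₀.changeBasis T).chargeConj⁻¹ = T.1 * S₀.chargeConj⁻¹ * (T.1)ᵀ := by
  have h : IsUnit (T.1 : Matrix (Fin 4) (Fin 4) ℂ)ᵀ.det := by
    rw [Matrix.det_transpose]; exact isUnit_det T
  simp only [SpinorRep.changeBasis, Matrix.mul_inv_rev, Matrix.nonsing_inv_nonsing_inv _ h,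
    Matrix.nonsing_inv_nonsing_inv _ (isUnit_det T), mul_assoc]

lemma bil_changeBasis (u w : Fin 4 → SusyPoly 2) :
    bil (S₀.changeBasis T).chargeConj⁻¹ (rowMul (T.1)⁻¹ u) (rowMul (T.1)⁻¹ w) =
      bil S₀.chargeConj⁻¹ u w := by
  rw [bil_rowMul, changeBasis_chargeConj_inv]
  congr 1
  rw [mul_assoc, mul_assoc, ← Matrix.transpose_mul, inv_mul_T, Matrix.transpose_one, mul_one,
    ← mul_assoc, inv_mul_T, one_mul]

lemma rowMul_conj (M : Matrix (Fin 4) (Fin 4) ℂ) (i : Fin 2) :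
    rowMul (T.1 * M * (T.1)⁻¹) (xi i) = rowMul (T.1)⁻¹ (rowMul M (newXi T i)) := by
  rw [newXi, rowMul_rowMul, rowMul_rowMul, mul_assoc]

lemma changeBasis_projPlus : (1 / 2 : ℂ) • (1 + (S₀.changeBasis T).chir) =
    T.1 * ((1 / 2 : ℂ) • (1 + S₀.chir)) * (T.1)⁻¹ := by
  simp only [SpinorRep.changeBasis, Matrix.mul_smul, Matrix.smul_mul, mul_add, add_mul, mul_one,
    mul_inv_T]
lemma changeBasis_projMinus : (1 / 2 : ℂ) • (1 - (S₀.changeBasis T).chir) =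
    T.1 * ((1 / 2 : ℂ) • (1 - S₀.chir)) * (T.1)⁻¹ := by
  simp only [SpinorRep.changeBasis, Matrix.mul_smul, Matrix.smul_mul, mul_sub, sub_mul, mul_one,
    mul_inv_T]

lemma xiPlus_changeBasis (i : Fin 2) : xiPlus (S₀.changeBasis T) i =
    rowMul (T.1)⁻¹ (rowMul ((1 / 2 : ℂ) • (1 + S₀.chir)) (newXi T i)) := by
  rw [← rowMul_conj, ← changeBasis_projPlus]
  ext1 α
  rw [rowMul_apply, xiPlus]
lemma xiMinus_changeBasis (i : Fin 2) : xiMinus (S₀.changeBasis T) i =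
    rowMul (T.1)⁻¹ (rowMul ((1 / 2 : ℂ) • (1 - S₀.chir)) (newXi T i)) := by
  rw [← rowMul_conj, ← changeBasis_projMinus]
  ext1 α
  rw [rowMul_apply, xiMinus]

lemma susyMatrix_apply (i j : Fin 2) : susyMatrix 2 i j = if i = j then -Complex.I else 0 := by
  simp [susyMatrix, Matrix.one_apply]

lemma bCoeff_changeBasis (a : Fin 4) : bCoeff (N := 2) (S₀.changeBasis T) t a =
    C (Complex.I / 2) * ∑ i, bil (S₀.gamUp t a * S₀.chargeConj⁻¹) (newXi T i) (newXi T i) := by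
  have h : (S₀.changeBasis T).gamUp t a * (S₀.changeBasis T).chargeConj⁻¹ =
      T.1 * (S₀.gamUp t a * S₀.chargeConj⁻¹) * (T.1)ᵀ := by
    rw [changeBasis_chargeConj_inv]
    simp only [SpinorRep.gamUp, SpinorRep.changeBasis, Matrix.smul_mul, Matrix.mul_smul]
    congr 1
    simp only [mul_assoc]
    rw [← mul_assoc (T.1)⁻¹ T.1, inv_mul_T, one_mul]
  unfold bCoeff
  rw [h]
  have h' : ∀ i, bil (S₀.gamUp t a * S₀.chargeConj⁻¹) (newXi T i) (newXi T i) =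
      bil (T.1 * (S₀.gamUp t a * S₀.chargeConj⁻¹) * (T.1)ᵀ) (xi i) (xi i) := fun i => by
    rw [newXi, bil_rowMul]
  simp only [h', bil_eq, Finset.mul_sum]
  refine Finset.sum_congr rfl fun i _ => ?_
  rw [Finset.sum_eq_single i]
  · refine Finset.sum_congr rfl fun α _ => Finset.sum_congr rfl fun β _ => ?_
    rw [susyMatrix_apply, if_pos rfl, ← mul_assoc (C (Complex.I / 2)), ← C_mul]
    congr 2
    ring
  · intro j _ hj
    simp [susyMatrix_apply, hj.symm]
  · simp

lemma varthetaPlus_eq (S : SpinorRep) (i : Fin 2) (α : Fin 4) : varthetaPlus S i α =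
    ∑ a, rowMul ((1 / 2 : ℂ) • (1 + S.chir)) (rowMul (S.gam a) (xi i)) α •
      (cGhost a : GhostPoly 2) := by
  have h : ∀ β, vartheta S i β = ∑ a, rowMul (S.gam a) (xi i) β • (cGhost a : GhostPoly 2) :=
    fun β => by simp only [vartheta, rowMul_apply, Finset.sum_smul]
  simp only [varthetaPlus, h, rowMul_apply _ (rowMul _ _), Finset.smul_sum, Finset.sum_smul,
    smul_smul]
  exact Finset.sum_comm

lemma Theta_eq (S : SpinorRep) (i j : Fin 2) : Theta S i j =
    ∑ a, bil S.chargeConj⁻¹ (rowMul ((1 / 2 : ℂ) • (1 + S.chir)) (rowMul (S.gam a) (xi i)))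
      (xiPlus S j) • cGhost a := by
  simp only [Theta, varthetaPlus_eq, bil_eq, Finset.smul_sum, Finset.sum_smul, smul_smul]
  refine Eq.trans (Finset.sum_congr rfl fun α _ => Finset.sum_comm) ?_
  rw [Finset.sum_comm]
  refine Finset.sum_congr rfl fun a _ => Finset.sum_congr rfl fun α _ =>
    Finset.sum_congr rfl fun β _ => ?_
  congr 1
  ring

lemma Theta_changeBasis (i j : Fin 2) : Theta (S₀.changeBasis T) i j =
    ∑ a, bil S₀.chargeConj⁻¹
      (rowMul ((1 / 2 : ℂ) • (1 + S₀.chir)) (rowMul (S₀.gam a) (newXi T i)))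
      (rowMul ((1 / 2 : ℂ) • (1 + S₀.chir)) (newXi T j)) • cGhost a := by
  have h : ∀ a, rowMul (T.1)⁻¹
      (rowMul ((1 / 2 : ℂ) • (1 + S₀.chir)) (rowMul (S₀.gam a) (newXi T i))) =
      rowMul ((1 / 2 : ℂ) • (1 + (S₀.changeBasis T).chir))
        (rowMul ((S₀.changeBasis T).gam a) (xi i)) := fun a => by
    rw [changeBasis_projPlus, newXi]
    simp only [SpinorRep.changeBasis, rowMul_rowMul]
    congr 1
    simp only [mul_assoc]
    rw [← mul_assoc (T.1)⁻¹ T.1, inv_mul_T, one_mul]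
  simp only [Theta_eq, ← bil_changeBasis T S₀, ← xiPlus_changeBasis, h]

end ChangeBasis

/-! ### The coboundary operator and the representatives in components -/

lemma particularRep_projPlus (t : ℕ) : (1 / 2 : ℂ) • (1 + (particularRep t).chir) =
    !![1, 0, 0, 0; 0, 0, 0, 0; 0, 0, 0, 0; 0, 0, 0, 1] := by
  rw [particularRep_chir]
  ext i j; fin_cases i <;> fin_cases j <;> simp <;> norm_num

lemma particularRep_projMinus (t : ℕ) : (1 / 2 : ℂ) • (1 - (particularRep t).chir) =
    !![0, 0, 0, 0; 0, 1, 0, 0; 0, 0, 1, 0; 0, 0, 0, 0] := by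
  rw [particularRep_chir]
  ext i j; fin_cases i <;> fin_cases j <;> simp <;> norm_num

section

variable (t : ℕ) (T : GL (Fin 4) ℂ)

lemma rotEquiv_x₁ : rotEquiv T x₁ = newXi T 0 0 := rotEquiv_xi T 0 0
lemma rotEquiv_x₂ : rotEquiv T x₂ = newXi T 0 3 := rotEquiv_xi T 0 3
lemma rotEquiv_y₁ : rotEquiv T y₁ = newXi T 0 1 := rotEquiv_xi T 0 1
lemma rotEquiv_y₂ : rotEquiv T y₂ = newXi T 0 2 := rotEquiv_xi T 0 2
lemma rotEquiv_a₁ : rotEquiv T a₁ = newXi T 1 0 := rotEquiv_xi T 1 0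
lemma rotEquiv_a₂ : rotEquiv T a₂ = newXi T 1 3 := rotEquiv_xi T 1 3
lemma rotEquiv_d₁ : rotEquiv T d₁ = newXi T 1 1 := rotEquiv_xi T 1 1
lemma rotEquiv_d₂ : rotEquiv T d₂ = newXi T 1 2 := rotEquiv_xi T 1 2

lemma rowMul_projPlus (u : Fin 4 → SusyPoly 2) :
    rowMul ((1 / 2 : ℂ) • (1 + (particularRep t).chir)) u = ![u 0, 0, 0, u 3] := by
  rw [particularRep_projPlus]
  ext1 i
  fin_cases i <;> simp [rowMul_apply, Fin.sum_univ_four]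

lemma rowMul_projMinus (u : Fin 4 → SusyPoly 2) :
    rowMul ((1 / 2 : ℂ) • (1 - (particularRep t).chir)) u = ![0, u 1, u 2, 0] := by
  rw [particularRep_projMinus]
  ext1 i
  fin_cases i <;> simp [rowMul_apply, Fin.sum_univ_four]

lemma bil_chargeConj (u w : Fin 4 → SusyPoly 2) : bil (particularRep t).chargeConj⁻¹ u w =
    C Complex.I * (-(u 0 * w 3) - u 1 * w 2 + u 2 * w 1 + u 3 * w 0) := by
  rw [particularRep_chargeConj_inv, particularRep_chargeConj]
  simp [bil_eq, Fin.sum_univ_four]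
  ring

lemma rotEquiv_quad : (fun e => rotEquiv T (quad e)) =
    ![newXi T 0 0 * newXi T 0 1 + newXi T 1 0 * newXi T 1 1,
      newXi T 0 0 * newXi T 0 2 + newXi T 1 0 * newXi T 1 2,
      newXi T 0 3 * newXi T 0 1 + newXi T 1 3 * newXi T 1 1,
      newXi T 0 3 * newXi T 0 2 + newXi T 1 3 * newXi T 1 2] := by
  ext1 e
  fin_cases e <;> simp [quad, quadLead, quadTwo, rotEquiv_x₁, rotEquiv_x₂, rotEquiv_y₁,
    rotEquiv_y₂, rotEquiv_a₁, rotEquiv_a₂, rotEquiv_d₁, rotEquiv_d₂]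

lemma C_I_mul : (C Complex.I * C Complex.I : SusyPoly 2) = -1 := by
  rw [← C_mul, Complex.I_mul_I, C_neg, C_1]

lemma two_mul_C_I_half : (2 * C (Complex.I / 2) : SusyPoly 2) = C Complex.I := by
  have : (2 : SusyPoly 2) = C 2 := (map_ofNat C 2).symm
  rw [this, ← C_mul]
  congr 1
  ring

lemma bil_smul (c : ℂ) (M : Matrix (Fin 4) (Fin 4) ℂ) (u w : Fin 4 → SusyPoly 2) :
    bil (c • M) u w = C c * bil M u w := by
  simp only [bil_eq, Finset.mul_sum, Matrix.smul_apply, smul_eq_mul, C_mul, mul_assoc]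

lemma gamUp_mul_zero : (particularRep t).gamUp t 0 * (particularRep t).chargeConj⁻¹ =
    (metricSign t 0 * kFactor t 0 * Complex.I) •
      !![0, 1, 0, 0; 1, 0, 0, 0; 0, 0, 0, -1; 0, 0, -1, 0] := by
  rw [particularRep_chargeConj_inv, SpinorRep.gamUp, particularRep_gam_zero,
    particularRep_chargeConj]
  simp only [smul_smul, Matrix.smul_mul]
  rw [mul_smul (_ * _) Complex.I]
  congr 1
  ext i j; fin_cases i <;> fin_cases j <;> simp [Matrix.mul_apply, Fin.sum_univ_four]
lemma gamUp_mul_one : (particularRep t).gamUp t 1 * (particularRep t).chargeConj⁻¹ =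
    (metricSign t 1 * kFactor t 1) •
      !![0, 1, 0, 0; 1, 0, 0, 0; 0, 0, 0, 1; 0, 0, 1, 0] := by
  rw [particularRep_chargeConj_inv, SpinorRep.gamUp, particularRep_gam_one,
    particularRep_chargeConj]
  simp only [smul_smul, Matrix.smul_mul]
  congr 1
  ext i j; fin_cases i <;> fin_cases j <;> simp [Matrix.mul_apply, Fin.sum_univ_four]
lemma gamUp_mul_two : (particularRep t).gamUp t 2 * (particularRep t).chargeConj⁻¹ =
    (metricSign t 2 * kFactor t 2 * -Complex.I) •
      !![0, 0, 1, 0; 0, 0, 0, 1; 1, 0, 0, 0; 0, 1, 0, 0] := by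
  rw [particularRep_chargeConj_inv, SpinorRep.gamUp, particularRep_gam_two,
    particularRep_chargeConj]
  simp only [smul_smul, Matrix.smul_mul]
  rw [mul_smul (_ * _) (-Complex.I)]
  congr 1
  ext i j; fin_cases i <;> fin_cases j <;> simp [Matrix.mul_apply, Fin.sum_univ_four]
lemma gamUp_mul_three : (particularRep t).gamUp t 3 * (particularRep t).chargeConj⁻¹ =
    (metricSign t 3 * kFactor t 3) •
      !![0, 0, -1, 0; 0, 0, 0, 1; -1, 0, 0, 0; 0, 1, 0, 0] := by
  rw [particularRep_chargeConj_inv, SpinorRep.gamUp, particularRep_gam_three,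
    particularRep_chargeConj]
  simp only [smul_smul, Matrix.smul_mul]
  congr 1
  ext i j; fin_cases i <;> fin_cases j <;> simp [Matrix.mul_apply, Fin.sum_univ_four]

/-- The coefficients of the coboundary operator in terms of the quadrics. -/
lemma bCoeff_eq : (fun a => bCoeff ((particularRep t).changeBasis T) t a) =
    ![-(C (metricSign t 0 * kFactor t 0) * (rotEquiv T (quad 0) - rotEquiv T (quad 3))),
      C (metricSign t 1 * kFactor t 1) *
        (C Complex.I * (rotEquiv T (quad 0) + rotEquiv T (quad 3))),
      C (metricSign t 2 * kFactor t 2) * (rotEquiv T (quad 1) + rotEquiv T (quad 2)),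
      -(C (metricSign t 3 * kFactor t 3) *
        (C Complex.I * (rotEquiv T (quad 1) - rotEquiv T (quad 2))))] := by
  have e0 : rotEquiv T (quad 0) = _ := congrFun (rotEquiv_quad T) 0
  have e1 : rotEquiv T (quad 1) = _ := congrFun (rotEquiv_quad T) 1
  have e2 : rotEquiv T (quad 2) = _ := congrFun (rotEquiv_quad T) 2
  have e3 : rotEquiv T (quad 3) = _ := congrFun (rotEquiv_quad T) 3
  rw [e0, e1, e2, e3]
  have h2 := two_mul_C_I_half
  have hI := C_I_mul
  have b0 : ∀ u : Fin 4 → SusyPoly 2, bil !![0, 1, 0, 0; 1, 0, 0, 0; 0, 0, 0, -1; 0, 0, -1, 0] u u =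
      2 * (u 0 * u 1 - u 3 * u 2) := fun u => by
    simp [bil_eq, Fin.sum_univ_four]; ring
  have b1 : ∀ u : Fin 4 → SusyPoly 2, bil !![0, 1, 0, 0; 1, 0, 0, 0; 0, 0, 0, 1; 0, 0, 1, 0] u u =
      2 * (u 0 * u 1 + u 3 * u 2) := fun u => by
    simp [bil_eq, Fin.sum_univ_four]; ring
  have b2 : ∀ u : Fin 4 → SusyPoly 2, bil !![0, 0, 1, 0; 0, 0, 0, 1; 1, 0, 0, 0; 0, 1, 0, 0] u u =
      2 * (u 0 * u 2 + u 3 * u 1) := fun u => by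
    simp [bil_eq, Fin.sum_univ_four]; ring
  have b3 : ∀ u : Fin 4 → SusyPoly 2, bil !![0, 0, -1, 0; 0, 0, 0, 1; -1, 0, 0, 0; 0, 1, 0, 0] u u =
      -2 * (u 0 * u 2 - u 3 * u 1) := fun u => by
    simp [bil_eq, Fin.sum_univ_four]; ring
  ext1 a
  rw [bCoeff_changeBasis, Fin.sum_univ_two]
  generalize newXi T 0 = u, newXi T 1 = w
  fin_cases a
  · simp only [Fin.zero_eta, gamUp_mul_zero, bil_smul, b0, C_mul, Matrix.cons_val]
    linear_combination C (metricSign t 0) * C (kFactor t 0) *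
      (u 0 * u 1 - u 3 * u 2 + (w 0 * w 1 - w 3 * w 2)) * (C Complex.I * h2 + hI)
  · simp only [Fin.mk_one, gamUp_mul_one, bil_smul, b1, C_mul, Matrix.cons_val]
    linear_combination C (metricSign t 1) * C (kFactor t 1) *
      (u 0 * u 1 + u 3 * u 2 + (w 0 * w 1 + w 3 * w 2)) * h2
  · simp only [Fin.reduceFinMk, gamUp_mul_two, bil_smul, b2, C_mul, C_neg, Matrix.cons_val]
    linear_combination -(C (metricSign t 2) * C (kFactor t 2) *
      (u 0 * u 2 + u 3 * u 1 + (w 0 * w 2 + w 3 * w 1)) * (C Complex.I * h2 + hI))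
  · simp only [Fin.reduceFinMk, gamUp_mul_three, bil_smul, b3, C_mul, Matrix.cons_val]
    linear_combination -(C (metricSign t 3) * C (kFactor t 3) *
      (u 0 * u 2 - u 3 * u 1 + (w 0 * w 2 - w 3 * w 1)) * h2)

/-- The combinations of the translation ghosts on which the coboundary operator takes the values
`rotEquiv T (quad e)`, written as coefficient vectors. -/
noncomputable def ghostVec : Fin 4 → (Fin 4 → SusyPoly 2) :=
  ![![-C (kFactor t 0 / 2), -(C Complex.I * C (kFactor t 1 / 2)), 0, 0],
    ![0, 0, C (kFactor t 2 / 2), C Complex.I * C (kFactor t 3 / 2)],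
    ![0, 0, C (kFactor t 2 / 2), -(C Complex.I * C (kFactor t 3 / 2))],
    ![C (kFactor t 0 / 2), -(C Complex.I * C (kFactor t 1 / 2)), 0, 0]]

/-- The dual coordinates of `ghostVec`. -/
noncomputable def ghostCoord (m : Fin 4 → SusyPoly 2) : Fin 4 → SusyPoly 2 :=
  let k : Fin 4 → SusyPoly 2 := fun a => C (metricSign t a * kFactor t a)
  ![C Complex.I * (k 1 * m 1) - k 0 * m 0, k 2 * m 2 - C Complex.I * (k 3 * m 3),
    k 2 * m 2 + C Complex.I * (k 3 * m 3), C Complex.I * (k 1 * m 1) + k 0 * m 0]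

lemma C_mul_C_half (a : Fin 4) :
    (C (metricSign t a * kFactor t a) * C (kFactor t a / 2) : SusyPoly 2) = C (1 / 2) := by
  rw [← C_mul]
  congr 1
  linear_combination (1 / 2) * metricSign_mul_kFactor t a

lemma two_mul_C_half : (2 * C (1 / 2) : SusyPoly 2) = 1 := by
  have : (2 : SusyPoly 2) = C 2 := (map_ofNat C 2).symm
  rw [this, ← C_mul, ← C_1]
  congr 1
  norm_num

lemma sum_ghostCoord (m : Fin 4 → SusyPoly 2) : m = ∑ e, ghostCoord t m e • ghostVec t e := by
  have h0 := C_mul_C_half t 0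
  have h1 := C_mul_C_half t 1
  have h2 := C_mul_C_half t 2
  have h3 := C_mul_C_half t 3
  have hh := two_mul_C_half
  have hI := C_I_mul
  ext1 a
  simp only [Fin.sum_univ_four, Pi.add_apply, Pi.smul_apply, smul_eq_mul, ghostCoord, ghostVec,
    Matrix.cons_val]
  fin_cases a <;> simp only [Fin.zero_eta, Fin.mk_one, Fin.reduceFinMk, Matrix.cons_val]
  · linear_combination -(m 0) * (2 * h0 + hh)
  · linear_combination -(m 1) * (2 * h1 + hh) +
      (2 * (C (metricSign t 1 * kFactor t 1) * C (kFactor t 1 / 2)) * m 1) * hI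
  · linear_combination -(m 2) * (2 * h2 + hh)
  · linear_combination -(m 3) * (2 * h3 + hh) +
      (2 * (C (metricSign t 3 * kFactor t 3) * C (kFactor t 3 / 2)) * m 3) * hI

/-- The vectors `ghostVec` have dual linear forms, namely the components of `ghostCoord`. -/
lemma exists_dual (e : Fin 4) : ∃ φ : Module.Dual (SusyPoly 2) (Fin 4 → SusyPoly 2),
    ∀ f, φ (ghostVec t f) = if f = e then 1 else 0 := by
  refine ⟨{ toFun := fun m => ghostCoord t m e, map_add' := ?_, map_smul' := ?_ }, ?_⟩
  · intro m n
    fin_cases e <;> simp [ghostCoord] <;> ring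
  · intro r m
    fin_cases e <;> simp [ghostCoord] <;> ring
  · have h0 := C_mul_C_half t 0
    have h1 := C_mul_C_half t 1
    have h2 := C_mul_C_half t 2
    have h3 := C_mul_C_half t 3
    have hh := two_mul_C_half
    have hI := C_I_mul
    intro f
    change ghostCoord t (ghostVec t f) e = _
    simp only [ghostCoord, ghostVec]
    generalize (C (metricSign t 0 * kFactor t 0) : SusyPoly 2) = k0 at *
    generalize (C (metricSign t 1 * kFactor t 1) : SusyPoly 2) = k1 at *
    generalize (C (metricSign t 2 * kFactor t 2) : SusyPoly 2) = k2 at *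
    generalize (C (metricSign t 3 * kFactor t 3) : SusyPoly 2) = k3 at *
    generalize (C (kFactor t 0 / 2) : SusyPoly 2) = l0 at *
    generalize (C (kFactor t 1 / 2) : SusyPoly 2) = l1 at *
    generalize (C (kFactor t 2 / 2) : SusyPoly 2) = l2 at *
    generalize (C (kFactor t 3 / 2) : SusyPoly 2) = l3 at *
    fin_cases e <;> fin_cases f <;> simp
    · linear_combination h0 + h1 + hh - k1 * l1 * hI
    · linear_combination h1 - h0 - k1 * l1 * hI
    · linear_combination h2 + h3 + hh - k3 * l3 * hI
    · linear_combination h2 - h3 + k3 * l3 * hI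
    · linear_combination h2 - h3 + k3 * l3 * hI
    · linear_combination h2 + h3 + hh - k3 * l3 * hI
    · linear_combination h1 - h0 - k1 * l1 * hI
    · linear_combination h0 + h1 + hh - k1 * l1 * hI

/-- The coboundary operator acts on components by the Koszul differentials of the quadrics. -/
lemma bOp_forms (p₀ : Fin 1 → SusyPoly 2) (p₁ : Fin 4 → SusyPoly 2) (p₂ : Fin 6 → SusyPoly 2)
    (p₃ : Fin 4 → SusyPoly 2) (p₄ : Fin 1 → SusyPoly 2) :
    bOp ((particularRep t).changeBasis T) t (forms (ghostVec t) p₀ p₁ p₂ p₃ p₄) =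
      forms (ghostVec t) (kos₁ (fun e => rotEquiv T (quad e)) *ᵥ p₁)
        (kos₂ (fun e => rotEquiv T (quad e)) *ᵥ p₂) (kos₃ (fun e => rotEquiv T (quad e)) *ᵥ p₃)
        (kos₄ (fun e => rotEquiv T (quad e)) *ᵥ p₄) 0 := by
  have h0 := C_mul_C_half t 0
  have h1 := C_mul_C_half t 1
  have h2 := C_mul_C_half t 2
  have h3 := C_mul_C_half t 3
  have hh := two_mul_C_half
  have hI := C_I_mul
  have hφ : ∀ e, (∑ a, bCoeff (N := 2) ((particularRep t).changeBasis T) t a •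
      (LinearMap.proj a : (Fin 4 → SusyPoly 2) →ₗ[SusyPoly 2] SusyPoly 2)) (ghostVec t e) =
      rotEquiv T (quad e) := by
    intro e
    have hb : ∀ a, bCoeff ((particularRep t).changeBasis T) t a = _ :=
      fun a => congrFun (bCoeff_eq t T) a
    refine (LinearMap.sum_apply ..).trans ?_
    simp only [LinearMap.smul_apply, LinearMap.proj_apply, smul_eq_mul, Fin.sum_univ_four, hb,
      Matrix.cons_val]
    fin_cases e <;> simp only [Fin.zero_eta, Fin.mk_one, Fin.reduceFinMk, ghostVec, Matrix.cons_val]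
    · generalize rotEquiv T (quad 0) = q, rotEquiv T (quad 3) = r
      linear_combination (q - r) * h0 + (q + r) * h1 -
        C (metricSign t 1 * kFactor t 1) * C (kFactor t 1 / 2) * (q + r) * hI + q * hh
    · generalize rotEquiv T (quad 1) = q, rotEquiv T (quad 2) = r
      linear_combination (q + r) * h2 + (q - r) * h3 -
        C (metricSign t 3 * kFactor t 3) * C (kFactor t 3 / 2) * (q - r) * hI + q * hh
    · generalize rotEquiv T (quad 1) = q, rotEquiv T (quad 2) = r
      linear_combination (q + r) * h2 - (q - r) * h3 +
        C (metricSign t 3 * kFactor t 3) * C (kFactor t 3 / 2) * (q - r) * hI + r * hh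
    · generalize rotEquiv T (quad 0) = q, rotEquiv T (quad 3) = r
      linear_combination -(q - r) * h0 + (q + r) * h1 -
        C (metricSign t 1 * kFactor t 1) * C (kFactor t 1 / 2) * (q + r) * hI + r * hh
  unfold bOp
  rw [contractLeft_forms]
  simp only [hφ]

lemma ι_eq_sum_cGhost (m : Fin 4 → SusyPoly 2) :
    ExteriorAlgebra.ι (SusyPoly 2) m = ∑ a, m a • (cGhost a : GhostPoly 2) := by
  have h : m = ∑ a, m a • (Pi.single a 1 : Fin 4 → SusyPoly 2) := by
    ext1 b
    simp [Finset.sum_apply, Pi.single_apply]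
  conv_lhs => rw [h]
  rw [map_sum]
  exact Finset.sum_congr rfl fun a _ => map_smul _ _ _

lemma forms_one_form (p : Fin 4 → SusyPoly 2) : forms (ghostVec t) 0 p 0 0 0 =
    ExteriorAlgebra.ι (SusyPoly 2) (∑ e, p e • ghostVec t e) := by
  simp only [forms, Pi.zero_apply, zero_smul, zero_add, add_zero, Fin.sum_univ_four, map_add,
    map_smul]

lemma bil_gam (u w : Fin 4 → SusyPoly 2) (a : Fin 4) :
    bil (particularRep t).chargeConj⁻¹
      (rowMul ((1 / 2 : ℂ) • (1 + (particularRep t).chir)) (rowMul ((particularRep t).gam a) u))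
      (rowMul ((1 / 2 : ℂ) • (1 + (particularRep t).chir)) w) =
    (∑ e, (![C (2 * Complex.I) * (u 2 * w 3), -(C (2 * Complex.I) * (u 1 * w 3)),
        -(C (2 * Complex.I) * (u 2 * w 0)), C (2 * Complex.I) * (u 1 * w 0)] :
          Fin 4 → SusyPoly 2) e • ghostVec t e) a := by
  rw [rowMul_projPlus, rowMul_projPlus, bil_chargeConj]
  have e2 : (C (2 * Complex.I) : SusyPoly 2) = 2 * C Complex.I := by
    rw [C_mul]; congr 1
  have hk : ∀ a, (C (kFactor t a) : SusyPoly 2) = 2 * C (kFactor t a / 2) := fun a => by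
    have : (2 : SusyPoly 2) = C 2 := (map_ofNat C 2).symm
    rw [this, ← C_mul]; congr 1; ring
  simp only [rowMul_apply, Pi.add_apply, Pi.smul_apply, ghostVec, e2, Fin.sum_univ_four,
    smul_eq_mul, Matrix.cons_val, mul_zero, sub_zero, add_zero]
  fin_cases a
  · simp only [Fin.zero_eta, particularRep_gam_zero, Matrix.smul_apply, Matrix.of_apply,
      Matrix.cons_val, smul_eq_mul, mul_zero, mul_one, C_0, hk, zero_mul, add_zero, zero_add]
    ring
  · simp only [Fin.mk_one, particularRep_gam_one, Matrix.smul_apply, Matrix.of_apply,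
      Matrix.cons_val, smul_eq_mul, mul_zero, mul_neg, C_neg, C_0, C_mul, hk, zero_mul, add_zero,
      zero_add]
    ring
  · simp only [Fin.reduceFinMk, particularRep_gam_two, Matrix.smul_apply, Matrix.of_apply,
      Matrix.cons_val, smul_eq_mul, mul_zero, mul_one, mul_neg, C_neg, C_0, hk, zero_mul, add_zero,
      zero_add]
    ring
  · simp only [Fin.reduceFinMk, particularRep_gam_three, Matrix.smul_apply, Matrix.of_apply,
      Matrix.cons_val, smul_eq_mul, mul_zero, mul_neg, C_0, C_mul, hk, zero_mul, add_zero,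
      zero_add]
    ring

/-- The components of `Θ_{ij}`. -/
lemma Theta_eq_forms (i j : Fin 2) : Theta ((particularRep t).changeBasis T) i j =
    forms (ghostVec t) 0
      ![C (2 * Complex.I) * (newXi T i 2 * newXi T j 3),
        -(C (2 * Complex.I) * (newXi T i 1 * newXi T j 3)),
        -(C (2 * Complex.I) * (newXi T i 2 * newXi T j 0)),
        C (2 * Complex.I) * (newXi T i 1 * newXi T j 0)] 0 0 0 := by
  rw [Theta_changeBasis]
  rw [forms_one_form, ι_eq_sum_cGhost]
  refine Finset.sum_congr rfl fun a _ => ?_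
  rw [bil_gam]

/-- The representatives in components with respect to `ghostVec`. -/
lemma representative_eq (P Q H G B : SusyPoly 2) :
    representative ((particularRep t).changeBasis T) (rotEquiv T P) (rotEquiv T Q)
      (rotEquiv T H) (rotEquiv T G) (rotEquiv T B) =
    forms (ghostVec t) (fun i => rotEquiv T (![P + Q] i))
      (fun i => rotEquiv T (reprOne (C (2 * Complex.I) * H) (C (2 * Complex.I) * G)
        (-(C (2 * Complex.I) * B)) i)) 0 0 0 := by
  have h0 : ∀ p : SusyPoly 2, algebraMap (SusyPoly 2) (GhostPoly 2) p =
      forms (ghostVec t) ![p] 0 0 0 0 := fun p => by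
    simp [forms, Algebra.algebraMap_eq_smul_one]
  have hs : ∀ (r : SusyPoly 2) (p : Fin 4 → SusyPoly 2), r • forms (ghostVec t) 0 p 0 0 0 =
      forms (ghostVec t) 0 (r • p) 0 0 0 := fun r p => by
    simp [forms, smul_smul]
  rw [representative, h0, Theta_eq_forms, Theta_eq_forms, Theta_eq_forms, Theta_eq_forms,
    forms_sub]
  simp only [sub_zero]
  rw [hs, hs, hs, forms_add, forms_add, forms_add]
  simp only [add_zero, zero_add]
  congr 1
  · ext1 i
    fin_cases i
    simp
  · ext1 i
    fin_cases i <;>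
      simp [reprOne, harm₁, kappa, rotEquiv_x₁, rotEquiv_x₂, rotEquiv_y₁, rotEquiv_y₂,
        rotEquiv_a₁, rotEquiv_a₂, rotEquiv_d₁, rotEquiv_d₂, rotEquiv_C, -map_mul, map_mul (rotEquiv T)] <;>
      ring

end

/-! ### Polynomial subalgebras and invariant products -/

section

variable (t : ℕ) (T : GL (Fin 4) ℂ)

lemma map_rowMul (f : SusyPoly 2 →ₐ[ℂ] SusyPoly 2) (M : Matrix (Fin 4) (Fin 4) ℂ)
    (u : Fin 4 → SusyPoly 2) (α : Fin 4) : f (rowMul M u α) = rowMul M (fun β => f (u β)) α := by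
  rw [rowMul_apply, rowMul_apply, map_sum]
  refine Finset.sum_congr rfl fun β _ => ?_
  rw [map_mul]
  congr 1
  exact f.commutes _

lemma rowMul_mem {A : Subalgebra ℂ (SusyPoly 2)} {u : Fin 4 → SusyPoly 2} (hu : ∀ α, u α ∈ A)
    (M : Matrix (Fin 4) (Fin 4) ℂ) (α : Fin 4) : rowMul M u α ∈ A := by
  rw [rowMul_apply]
  exact sum_mem fun β _ => mul_mem (A.algebraMap_mem (M β α)) (hu β)

lemma newXi_one_mem {A : Subalgebra ℂ (SusyPoly 2)} (hA : Set.range (xi 1) ⊆ (A : Set (SusyPoly 2)))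
    (α : Fin 4) : newXi T 1 α ∈ A :=
  rowMul_mem (fun β => hA ⟨β, rfl⟩) _ _

lemma xi_eq_rotEquiv (i : Fin 2) (α : Fin 4) :
    xi i α = rotEquiv T (rowMul (T.1)⁻¹ (xi i) α) := by
  have h : rotEquiv T (rowMul (T.1)⁻¹ (xi i) α) = rowMul (T.1)⁻¹ (newXi T i) α :=
    (map_rowMul (rotEquiv T : SusyPoly 2 →ₐ[ℂ] SusyPoly 2) _ _ _).trans <| by
      congr 1; ext1 β; exact rotEquiv_xi T i β
  rw [h, newXi, rowMul_rowMul, mul_inv_T, rowMul_one]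

lemma rowMul_newXi_eq (M : Matrix (Fin 4) (Fin 4) ℂ) (i : Fin 2) (α : Fin 4) :
    rowMul (T.1)⁻¹ (rowMul M (newXi T i)) α =
      rotEquiv T (rowMul (T.1)⁻¹ (rowMul M (xi i)) α) := by
  rw [rowMul_rowMul, rowMul_rowMul]
  refine Eq.symm ((map_rowMul (rotEquiv T : SusyPoly 2 →ₐ[ℂ] SusyPoly 2) _ _ _).trans ?_)
  congr 1; ext1 β; exact rotEquiv_xi T i β

lemma xiMinus_eq (i : Fin 2) : xiMinus ((particularRep t).changeBasis T) i =
    rowMul (T.1)⁻¹ ![0, newXi T i 1, newXi T i 2, 0] := by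
  rw [xiMinus_changeBasis, rowMul_projMinus]
lemma xiPlus_eq (i : Fin 2) : xiPlus ((particularRep t).changeBasis T) i =
    rowMul (T.1)⁻¹ ![newXi T i 0, 0, 0, newXi T i 3] := by
  rw [xiPlus_changeBasis, rowMul_projPlus]

/-- If `s` consists of images of fixed points of `f` and its polynomials contain the images of all
`f (X v)`, then the polynomials in `s` are the image of the fixed ring of `f`. -/
lemma rotEquiv_mem_iff (f : SusyPoly 2 →ₐ[ℂ] SusyPoly 2) (s : Set (SusyPoly 2))
    (hs : ∀ g ∈ s, ∃ p, f p = p ∧ g = rotEquiv T p)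
    (hf : ∀ v, rotEquiv T (f (X v)) ∈ Algebra.adjoin ℂ s) (p : SusyPoly 2) :
    rotEquiv T p ∈ Algebra.adjoin ℂ s ↔ f p = p := by
  constructor
  · intro h
    have hle : Algebra.adjoin ℂ s ≤ (AlgHom.equalizer f (AlgHom.id ℂ _)).map
        (rotEquiv T : SusyPoly 2 →ₐ[ℂ] SusyPoly 2) := by
      refine Algebra.adjoin_le fun g hg => ?_
      obtain ⟨p, hp, rfl⟩ := hs g hg
      exact ⟨p, hp, rfl⟩
    obtain ⟨q, hq, hqp⟩ := hle h
    rw [← (rotEquiv T).injective hqp]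
    exact hq
  · intro h
    rw [← h]
    clear h
    induction p using MvPolynomial.induction_on with
    | C r =>
      have : f (C r) = C r := f.commutes r
      rw [this, rotEquiv_C]
      exact Subalgebra.algebraMap_mem _ r
    | add p q hp hq => rw [map_add, map_add]; exact add_mem hp hq
    | mul_X p v hp => rw [map_mul, map_mul]; exact mul_mem hp (hf v)

lemma rotEquiv_mem_polyMinus (p : SusyPoly 2) :
    rotEquiv T p ∈ polyMinus ((particularRep t).changeBasis T) ↔ killX p = p := by
  refine rotEquiv_mem_iff T killX _ ?_ ?_ p
  · rintro _ (⟨α, rfl⟩ | ⟨α, rfl⟩)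
    · refine ⟨rowMul (T.1)⁻¹ (rowMul ((1 / 2 : ℂ) • (1 - (particularRep t).chir)) (xi 0)) α, ?_, ?_⟩
      · rw [map_rowMul, rowMul_projMinus]
        congr 1; ext1 β
        fin_cases β <;> simp [xi, killX]
      · rw [xiMinus_changeBasis, rowMul_newXi_eq]
    · refine ⟨rowMul (T.1)⁻¹ (xi 1) α, ?_, xi_eq_rotEquiv T 1 α⟩
      rw [map_rowMul]
      congr 1; ext1 β
      simp [xi, killX]
  · have h0 : ∀ α, ![0, newXi T 0 1, newXi T 0 2, 0] α ∈
        polyMinus ((particularRep t).changeBasis T) := fun α => by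
      have h : ![0, newXi T 0 1, newXi T 0 2, 0] =
          rowMul T.1 (xiMinus ((particularRep t).changeBasis T) 0) := by
        rw [xiMinus_eq, rowMul_rowMul, inv_mul_T, rowMul_one]
      rw [h]
      exact rowMul_mem (fun β => Algebra.subset_adjoin (Or.inl ⟨β, rfl⟩)) _ _
    have h1 : ∀ α, newXi T 1 α ∈ polyMinus ((particularRep t).changeBasis T) := fun α =>
      newXi_one_mem T (fun g hg => Algebra.subset_adjoin (Or.inr hg)) α
    rintro ⟨i, α⟩
    rw [killX, aeval_X]
    split_ifs with h
    · rw [map_zero]; exact zero_mem _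
    · change rotEquiv T (xi i α) ∈ _
      rw [rotEquiv_xi]
      fin_cases i
      · fin_cases α
        · simp at h
        · exact h0 1
        · exact h0 2
        · simp at h
      · exact h1 α

lemma rotEquiv_mem_polyPlus (p : SusyPoly 2) :
    rotEquiv T p ∈ polyPlus ((particularRep t).changeBasis T) ↔ killY p = p := by
  refine rotEquiv_mem_iff T killY _ ?_ ?_ p
  · rintro _ (⟨α, rfl⟩ | ⟨α, rfl⟩)
    · refine ⟨rowMul (T.1)⁻¹ (rowMul ((1 / 2 : ℂ) • (1 + (particularRep t).chir)) (xi 0)) α, ?_, ?_⟩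
      · rw [map_rowMul, rowMul_projPlus]
        congr 1; ext1 β
        fin_cases β <;> simp [xi, killY]
      · rw [xiPlus_changeBasis, rowMul_newXi_eq]
    · refine ⟨rowMul (T.1)⁻¹ (xi 1) α, ?_, xi_eq_rotEquiv T 1 α⟩
      rw [map_rowMul]
      congr 1; ext1 β
      simp [xi, killY]
  · have h0 : ∀ α, ![newXi T 0 0, 0, 0, newXi T 0 3] α ∈
        polyPlus ((particularRep t).changeBasis T) := fun α => by
      have h : ![newXi T 0 0, 0, 0, newXi T 0 3] =
          rowMul T.1 (xiPlus ((particularRep t).changeBasis T) 0) := by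
        rw [xiPlus_eq, rowMul_rowMul, inv_mul_T, rowMul_one]
      rw [h]
      exact rowMul_mem (fun β => Algebra.subset_adjoin (Or.inl ⟨β, rfl⟩)) _ _
    have h1 : ∀ α, newXi T 1 α ∈ polyPlus ((particularRep t).changeBasis T) := fun α =>
      newXi_one_mem T (fun g hg => Algebra.subset_adjoin (Or.inr hg)) α
    rintro ⟨i, α⟩
    rw [killY, aeval_X]
    split_ifs with h
    · rw [map_zero]; exact zero_mem _
    · change rotEquiv T (xi i α) ∈ _
      rw [rotEquiv_xi]
      fin_cases i
      · fin_cases α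
        · exact h0 0
        · simp at h
        · simp at h
        · exact h0 3
      · exact h1 α

lemma rotEquiv_mem_polyTwo (p : SusyPoly 2) :
    rotEquiv T p ∈ polyTwo ↔ killX p = p ∧ killY p = p := by
  have hfix : rotEquiv T p ∈ polyTwo ↔ (killX.comp killY) p = p := by
    refine rotEquiv_mem_iff T _ _ ?_ ?_ p
    · rintro _ ⟨α, rfl⟩
      refine ⟨rowMul (T.1)⁻¹ (xi 1) α, ?_, xi_eq_rotEquiv T 1 α⟩
      rw [map_rowMul]
      congr 1; ext1 β
      simp [xi, killX, killY]
    · rintro ⟨i, α⟩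
      fin_cases i
      · have : killX (killY (X (0, α))) = 0 := by
          fin_cases α <;> simp [killX, killY]
        simp [this]
      · have : killX (killY (X (1, α))) = X (1, α) := by simp [killX, killY]
        simp only [AlgHom.comp_apply, Fin.mk_one, this]
        change rotEquiv T (xi 1 α) ∈ _
        rw [rotEquiv_xi]
        exact newXi_one_mem T Algebra.subset_adjoin α
  rw [hfix, AlgHom.comp_apply]
  constructor
  · intro h
    exact ⟨by rw [← h, killX_killX], by rw [← h, ← killX_killY, killY_killY]⟩
  · rintro ⟨h, h'⟩
    rw [h', h]

lemma spinorProd_minus : spinorProd ((particularRep t).changeBasis T)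
    (xiMinus ((particularRep t).changeBasis T) 0) (xiMinus ((particularRep t).changeBasis T) 1) =
    rotEquiv T (C Complex.I * detMinus) := by
  have h : ∀ S u w, spinorProd (N := 2) S u w = bil S.chargeConj⁻¹ u w :=
    fun S u w => (bil_eq _ u w).symm
  rw [h, xiMinus_eq, xiMinus_eq, bil_changeBasis, bil_chargeConj, map_mul, rotEquiv_C, detMinus,
    map_sub, map_mul, map_mul, rotEquiv_y₁, rotEquiv_y₂, rotEquiv_d₁, rotEquiv_d₂]
  simp
  ring

lemma spinorProd_plus : spinorProd ((particularRep t).changeBasis T)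
    (xiPlus ((particularRep t).changeBasis T) 0) (xiPlus ((particularRep t).changeBasis T) 1) =
    rotEquiv T (C Complex.I * detPlus) := by
  have h : ∀ S u w, spinorProd (N := 2) S u w = bil S.chargeConj⁻¹ u w :=
    fun S u w => (bil_eq _ u w).symm
  rw [h, xiPlus_eq, xiPlus_eq, bil_changeBasis, bil_chargeConj, map_mul, rotEquiv_C, detPlus,
    map_sub, map_mul, map_mul, rotEquiv_x₁, rotEquiv_x₂, rotEquiv_a₁, rotEquiv_a₂]
  simp
  ring

lemma sum_rowMul_inv_mul (u w : Fin 4 → SusyPoly 2) :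
    ∑ α, rowMul (T.1)⁻¹ u α * w α = ∑ α, u α * rowMul ((T.1)⁻¹)ᵀ w α := by
  have h : ∀ u w : Fin 4 → SusyPoly 2, ∑ α, u α * w α = bil 1 u w := fun u w => by
    simp [bil_eq, Matrix.one_apply]
  rw [h, h]
  conv_lhs => rw [← rowMul_one w]
  conv_rhs => rw [← rowMul_one u]
  rw [bil_rowMul, bil_rowMul]
  simp

end

/-! ### The cohomology of the coboundary operator -/

section

variable {R R' : Type*} [CommRing R] [CommRing R'] (f : R →+* R')

lemma map_kos₁ (q p : Fin 4 → R) : kos₁ (fun e => f (q e)) *ᵥ (fun e => f (p e)) =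
    fun i => f ((kos₁ q *ᵥ p) i) := by
  rw [kos₁_mulVec, kos₁_mulVec]; ext1 i; fin_cases i; simp
lemma map_kos₂ (q : Fin 4 → R) (p : Fin 6 → R) :
    kos₂ (fun e => f (q e)) *ᵥ (fun e => f (p e)) = fun i => f ((kos₂ q *ᵥ p) i) := by
  rw [kos₂_mulVec, kos₂_mulVec]; ext1 i; fin_cases i <;> simp
lemma map_kos₃ (q p : Fin 4 → R) : kos₃ (fun e => f (q e)) *ᵥ (fun e => f (p e)) =
    fun i => f ((kos₃ q *ᵥ p) i) := by
  rw [kos₃_mulVec, kos₃_mulVec]; ext1 i; fin_cases i <;> simp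
lemma map_kos₄ (q : Fin 4 → R) (p : Fin 1 → R) :
    kos₄ (fun e => f (q e)) *ᵥ (fun e => f (p e)) = fun i => f ((kos₄ q *ᵥ p) i) := by
  rw [kos₄_mulVec, kos₄_mulVec]; ext1 i; fin_cases i <;> simp

end

/-- Two-form cocycles are boundaries. -/
lemma exists_eq_kos₃ (p : Fin 6 → SusyPoly 2) (hp : kos₂ quad *ᵥ p = 0) :
    ∃ η, p = kos₃ quad *ᵥ η := by
  obtain ⟨h, ⟨P, Q, hP, hQ, rfl⟩, η, rfl⟩ := koszul_two p (by rw [hp]; exact zero_mem_Harm₁ _)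
  rw [Matrix.mulVec_add, Matrix.mulVec_mulVec, kos₂_mul_kos₃, Matrix.zero_mulVec, add_zero,
    kos₂_harm₂] at hp
  have h0 := congrFun hp 0
  simp [harm₁] at h0
  have hP0 : P = 0 := by simpa [hP, y₂_ne, a₂_ne, detMinus_ne] using congrArg killX h0
  have hQ0 : Q = 0 := by simpa [hQ, x₂_ne, d₂_ne, detPlus_ne] using congrArg killY h0
  subst hP0 hQ0
  refine ⟨η, ?_⟩
  have : harm₂ 0 0 = 0 := by ext1 i; fin_cases i <;> simp [harm₂]
  rw [this, zero_add]

section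

variable (t : ℕ) (T : GL (Fin 4) ℂ)

/-- The ghost polynomial whose components with respect to `ghostVec` arise from `p₀, …, p₄` by the
substitution `ξ_i ↦ ξ_i T`. -/
noncomputable def assemble (p₀ : Fin 1 → SusyPoly 2) (p₁ : Fin 4 → SusyPoly 2)
    (p₂ : Fin 6 → SusyPoly 2) (p₃ : Fin 4 → SusyPoly 2) (p₄ : Fin 1 → SusyPoly 2) : GhostPoly 2 :=
  forms (ghostVec t) (fun i => rotEquiv T (p₀ i)) (fun i => rotEquiv T (p₁ i))
    (fun i => rotEquiv T (p₂ i)) (fun i => rotEquiv T (p₃ i)) (fun i => rotEquiv T (p₄ i))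

lemma exists_assemble (ω : GhostPoly 2) : ∃ p₀ p₁ p₂ p₃ p₄, ω = assemble t T p₀ p₁ p₂ p₃ p₄ := by
  obtain ⟨p₀, p₁, p₂, p₃, p₄, rfl⟩ :=
    exists_forms (v := ghostVec t) (fun m => ⟨_, sum_ghostCoord t m⟩) ω
  refine ⟨fun i => (rotEquiv T).symm (p₀ i), fun i => (rotEquiv T).symm (p₁ i),
    fun i => (rotEquiv T).symm (p₂ i), fun i => (rotEquiv T).symm (p₃ i),
    fun i => (rotEquiv T).symm (p₄ i), ?_⟩
  simp only [assemble, AlgEquiv.apply_symm_apply]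

variable {t T}

lemma eq_zero_of_assemble_eq_zero {p₀ : Fin 1 → SusyPoly 2} {p₁ : Fin 4 → SusyPoly 2}
    {p₂ : Fin 6 → SusyPoly 2} {p₃ : Fin 4 → SusyPoly 2} {p₄ : Fin 1 → SusyPoly 2}
    (h : assemble t T p₀ p₁ p₂ p₃ p₄ = 0) : p₀ = 0 ∧ p₁ = 0 ∧ p₂ = 0 ∧ p₃ = 0 ∧ p₄ = 0 := by
  have hz : ∀ {ι : Type} {p : ι → SusyPoly 2}, (fun i => rotEquiv T (p i)) = 0 → p = 0 :=
    fun hp => funext fun i => (map_eq_zero_iff _ (rotEquiv T).injective).1 (congrFun hp i)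
  obtain ⟨h₀, h₁, h₂, h₃, h₄⟩ := eq_zero_of_forms_eq_zero (exists_dual t) h
  exact ⟨hz h₀, hz h₁, hz h₂, hz h₃, hz h₄⟩

lemma assemble_sub (p₀ p₀' : Fin 1 → SusyPoly 2) (p₁ p₁' : Fin 4 → SusyPoly 2)
    (p₂ p₂' : Fin 6 → SusyPoly 2) (p₃ p₃' : Fin 4 → SusyPoly 2) (p₄ p₄' : Fin 1 → SusyPoly 2) :
    assemble t T p₀ p₁ p₂ p₃ p₄ - assemble t T p₀' p₁' p₂' p₃' p₄' =
      assemble t T (p₀ - p₀') (p₁ - p₁') (p₂ - p₂') (p₃ - p₃') (p₄ - p₄') := by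
  rw [assemble, assemble, forms_sub, assemble]
  simp only [Pi.sub_apply, map_sub]
  rfl

lemma assemble_zero : assemble t T 0 0 0 0 0 = 0 := by
  simp [assemble, forms]

lemma bOp_assemble (p₀ : Fin 1 → SusyPoly 2) (p₁ : Fin 4 → SusyPoly 2)
    (p₂ : Fin 6 → SusyPoly 2) (p₃ : Fin 4 → SusyPoly 2) (p₄ : Fin 1 → SusyPoly 2) :
    bOp ((particularRep t).changeBasis T) t (assemble t T p₀ p₁ p₂ p₃ p₄) =
      assemble t T (kos₁ quad *ᵥ p₁) (kos₂ quad *ᵥ p₂) (kos₃ quad *ᵥ p₃) (kos₄ quad *ᵥ p₄) 0 := by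
  rw [assemble, bOp_forms, assemble]
  have h₁ := map_kos₁ (rotEquiv T : SusyPoly 2 →+* SusyPoly 2) quad p₁
  have h₂ := map_kos₂ (rotEquiv T : SusyPoly 2 →+* SusyPoly 2) quad p₂
  have h₃ := map_kos₃ (rotEquiv T : SusyPoly 2 →+* SusyPoly 2) quad p₃
  have h₄ := map_kos₄ (rotEquiv T : SusyPoly 2 →+* SusyPoly 2) quad p₄
  simp only [RingHom.coe_coe] at h₁ h₂ h₃ h₄
  rw [h₁, h₂, h₃, h₄]
  simp only [Pi.zero_apply, map_zero]
  rfl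

lemma representative_eq_assemble (P Q H G B : SusyPoly 2) :
    representative ((particularRep t).changeBasis T) (rotEquiv T P) (rotEquiv T Q)
      (rotEquiv T H) (rotEquiv T G) (rotEquiv T B) =
    assemble t T ![P + Q] (reprOne (C (2 * Complex.I) * H) (C (2 * Complex.I) * G)
        (-(C (2 * Complex.I) * B))) 0 0 0 := by
  rw [representative_eq, assemble]
  simp only [Pi.zero_apply, map_zero]
  rfl

end

lemma C_two_I_mul : (C (2 * Complex.I) * C (-(Complex.I / 2)) : SusyPoly 2) = 1 := by
  rw [← C_mul, ← C_1]
  congr 1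
  linear_combination -Complex.I_mul_I

lemma killX_C_mul (r : ℂ) (p : SusyPoly 2) : killX (C r * p) = C r * killX p := by
  rw [map_mul]; congr 1; exact killX.commutes r
lemma killY_C_mul (r : ℂ) (p : SusyPoly 2) : killY (C r * p) = C r * killY p := by
  rw [map_mul]; congr 1; exact killY.commutes r

/-- The form degrees zero and one of a representative can be tested separately for being
boundaries. -/
lemma cohEquiv_zero_iff (t : ℕ) (T : GL (Fin 4) ℂ) (P Q H G B : SusyPoly 2) :
    CohEquiv ((particularRep t).changeBasis T) t 0
      (representative ((particularRep t).changeBasis T) (rotEquiv T P) (rotEquiv T Q)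
        (rotEquiv T H) (rotEquiv T G) (rotEquiv T B)) ↔
    (∃ η, ![P + Q] = kos₁ quad *ᵥ η) ∧
      ∃ η, reprOne (C (2 * Complex.I) * H) (C (2 * Complex.I) * G)
        (-(C (2 * Complex.I) * B)) = kos₂ quad *ᵥ η := by
  rw [CohEquiv, representative_eq_assemble]
  constructor
  · rintro ⟨η, hη⟩
    obtain ⟨p₀, p₁, p₂, p₃, p₄, rfl⟩ := exists_assemble t T η
    rw [bOp_assemble, ← assemble_zero (t := t) (T := T), assemble_sub, ← sub_eq_zero,
      assemble_sub] at hη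
    obtain ⟨h₀, h₁, -⟩ := eq_zero_of_assemble_eq_zero hη
    refine ⟨⟨-p₁, ?_⟩, ⟨-p₂, ?_⟩⟩ <;> rw [Matrix.mulVec_neg]
    · rw [← sub_eq_zero.1 h₀, zero_sub, neg_neg]
    · rw [← sub_eq_zero.1 h₁, zero_sub, neg_neg]
  · rintro ⟨⟨η₁, h₁⟩, ⟨η₂, h₂⟩⟩
    refine ⟨assemble t T 0 (-η₁) (-η₂) 0 0, ?_⟩
    rw [bOp_assemble, ← assemble_zero (t := t) (T := T), assemble_sub, h₁, h₂]
    simp only [Matrix.mulVec_neg, Matrix.mulVec_zero, zero_sub, sub_zero]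

lemma sum_xiPlus_mul (t : ℕ) (T : GL (Fin 4) ℂ) (w : Fin 4 → SusyPoly 2) :
    ∑ α, xiPlus ((particularRep t).changeBasis T) 1 α * w α =
      rotEquiv T a₁ * rowMul ((T.1)⁻¹)ᵀ w 0 + rotEquiv T a₂ * rowMul ((T.1)⁻¹)ᵀ w 3 := by
  rw [xiPlus_eq, sum_rowMul_inv_mul, Fin.sum_univ_four, rotEquiv_a₁, rotEquiv_a₂]
  simp

lemma sum_xiMinus_mul (t : ℕ) (T : GL (Fin 4) ℂ) (w : Fin 4 → SusyPoly 2) :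
    ∑ α, xiMinus ((particularRep t).changeBasis T) 1 α * w α =
      rotEquiv T d₁ * rowMul ((T.1)⁻¹)ᵀ w 1 + rotEquiv T d₂ * rowMul ((T.1)⁻¹)ᵀ w 2 := by
  rw [xiMinus_eq, sum_rowMul_inv_mul, Fin.sum_univ_four, rotEquiv_d₁, rotEquiv_d₂]
  simp

lemma rowMul_transpose_inv (T : GL (Fin 4) ℂ) (u : Fin 4 → SusyPoly 2) :
    rowMul ((T.1)⁻¹)ᵀ (rowMul (T.1)ᵀ u) = u := by
  rw [rowMul_rowMul, ← Matrix.transpose_mul, inv_mul_T, Matrix.transpose_one, rowMul_one]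

/-- The form-degree-zero coboundaries in terms of the coordinates adapted to `T` and in covariant
form. -/
lemma zero_form_boundary_iff (t : ℕ) (T : GL (Fin 4) ℂ) (p : SusyPoly 2) :
    (∃ P₁ P₂ Q₁ Q₂, killX P₁ = P₁ ∧ killX P₂ = P₂ ∧ killY Q₁ = Q₁ ∧ killY Q₂ = Q₂ ∧
      p = detMinus * (a₁ * P₁ + a₂ * P₂) + detPlus * (d₁ * Q₁ + d₂ * Q₂)) ↔
    ∃ P' Q' : Fin 4 → SusyPoly 2,
      (∀ α, P' α ∈ polyMinus ((particularRep t).changeBasis T)) ∧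
      (∀ α, Q' α ∈ polyPlus ((particularRep t).changeBasis T)) ∧
      rotEquiv T p =
        rotEquiv T (C Complex.I * detMinus) *
          ∑ α, xiPlus ((particularRep t).changeBasis T) 1 α * P' α +
        rotEquiv T (C Complex.I * detPlus) *
          ∑ α, xiMinus ((particularRep t).changeBasis T) 1 α * Q' α := by
  constructor
  · rintro ⟨P₁, P₂, Q₁, Q₂, hP₁, hP₂, hQ₁, hQ₂, rfl⟩
    refine ⟨rowMul (T.1)ᵀ fun α => rotEquiv T (![-(C Complex.I * P₁), 0, 0,
        -(C Complex.I * P₂)] α),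
      rowMul (T.1)ᵀ fun α => rotEquiv T (![0, -(C Complex.I * Q₁), -(C Complex.I * Q₂), 0] α),
      rowMul_mem (fun α => (rotEquiv_mem_polyMinus t T _).2 ?_) _,
      rowMul_mem (fun α => (rotEquiv_mem_polyPlus t T _).2 ?_) _, ?_⟩
    · fin_cases α <;> simp [killX_C_mul, hP₁, hP₂]
    · fin_cases α <;> simp [killY_C_mul, hQ₁, hQ₂]
    · rw [sum_xiPlus_mul, sum_xiMinus_mul, rowMul_transpose_inv, rowMul_transpose_inv]
      simp only [Matrix.cons_val, ← map_mul, ← map_add]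
      refine congrArg (rotEquiv T) ?_
      have e : ∀ D D' p₁ p₂ q₁ q₂ r₁ r₂ s₁ s₂ j : SusyPoly 2, j * j = -1 →
          D * (r₁ * p₁ + r₂ * p₂) + D' * (s₁ * q₁ + s₂ * q₂) =
          j * D * (r₁ * -(j * p₁) + r₂ * -(j * p₂)) +
            j * D' * (s₁ * -(j * q₁) + s₂ * -(j * q₂)) := by
        intro D D' p₁ p₂ q₁ q₂ r₁ r₂ s₁ s₂ j hj
        linear_combination (D * (r₁ * p₁ + r₂ * p₂) + D' * (s₁ * q₁ + s₂ * q₂)) * hj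
      exact e _ _ _ _ _ _ _ _ _ _ _ C_I_mul
  · rintro ⟨P', Q', hP', hQ', h⟩
    have hP := fun α => rowMul_mem hP' ((T.1)⁻¹)ᵀ α
    have hQ := fun α => rowMul_mem hQ' ((T.1)⁻¹)ᵀ α
    rw [sum_xiPlus_mul, sum_xiMinus_mul] at h
    obtain ⟨u, hu⟩ : ∃ u, ∀ α, rowMul ((T.1)⁻¹)ᵀ P' α = rotEquiv T (u α) :=
      ⟨fun α => (rotEquiv T).symm (rowMul ((T.1)⁻¹)ᵀ P' α), by simp⟩
    obtain ⟨w, hw⟩ : ∃ w, ∀ α, rowMul ((T.1)⁻¹)ᵀ Q' α = rotEquiv T (w α) :=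
      ⟨fun α => (rotEquiv T).symm (rowMul ((T.1)⁻¹)ᵀ Q' α), by simp⟩
    simp only [hu, hw, rotEquiv_mem_polyMinus, rotEquiv_mem_polyPlus] at hP hQ h
    simp only [← map_mul, ← map_add] at h
    refine ⟨C Complex.I * u 0, C Complex.I * u 3, C Complex.I * w 1, C Complex.I * w 2,
      by rw [killX_C_mul, hP], by rw [killX_C_mul, hP], by rw [killY_C_mul, hQ],
      by rw [killY_C_mul, hQ], ?_⟩
    rw [(rotEquiv T).injective h]
    ring

/-- Divisibility with a quotient in a subalgebra that corresponds, under `rotEquiv T`, to the fixed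
points of a projection; the scalars are those by which `Θ` and the invariant products differ from
their coordinate expressions. -/
lemma exists_mul_iff (T : GL (Fin 4) ℂ) {A : Subalgebra ℂ (SusyPoly 2)}
    {f : SusyPoly 2 →ₐ[ℂ] SusyPoly 2} (hA : ∀ p, rotEquiv T p ∈ A ↔ f p = p)
    (d h : SusyPoly 2) :
    (∃ p, f p = p ∧ C (2 * Complex.I) * h = d * p) ↔
      ∃ p' ∈ A, rotEquiv T h = rotEquiv T (C Complex.I * d) * p' := by
  have hf : ∀ r p, f (C r * p) = C r * f p := fun r p => by
    rw [map_mul]; congr 1; exact f.commutes r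
  constructor
  · rintro ⟨p, hp, h'⟩
    refine ⟨rotEquiv T (C (-1 / 2) * p), (hA _).2 (by rw [hf, hp]), ?_⟩
    rw [← map_mul]
    congr 1
    have e : (C Complex.I * C (-1 / 2) : SusyPoly 2) = C (-(Complex.I / 2)) := by
      rw [← C_mul]; congr 1; ring
    linear_combination C (-(Complex.I / 2)) * h' - h * C_two_I_mul - d * p * e
  · rintro ⟨p', hp', h'⟩
    obtain ⟨p, rfl⟩ := (rotEquiv T).surjective p'
    rw [← map_mul] at h'
    refine ⟨C (-2) * p, by rw [hf, (hA p).1 hp'], ?_⟩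
    have e : (C (2 * Complex.I) * C Complex.I : SusyPoly 2) = C (-2) := by
      rw [← C_mul]; congr 1; linear_combination 2 * Complex.I_mul_I
    rw [(rotEquiv T).injective h']
    linear_combination d * p * e

end SusyCohomology


open SusyCohomology in
theorem mainTheorem2 (t : ℕ) (ht : t ≤ 4) (S : SpinorRep)
    (hS : S.IsEquivTo (particularRep t)) :
    (∀ ω : GhostPoly 2,
      bOp S t ω = 0 ↔
        ∃ P ∈ polyMinus S, ∃ Q ∈ polyPlus S, ∃ H ∈ polyMinus S, ∃ G ∈ polyPlus S,
          ∃ B ∈ polyTwo, CohEquiv S t ω (representative S P Q H G B)) ∧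
    (∀ P ∈ polyMinus S, ∀ Q ∈ polyPlus S, ∀ H ∈ polyMinus S, ∀ G ∈ polyPlus S, ∀ B ∈ polyTwo,
      CohEquiv S t 0 (representative S P Q H G B) ↔
        (∃ P' : Fin 4 → SusyPoly 2, ∃ Q' : Fin 4 → SusyPoly 2,
          (∀ α, P' α ∈ polyMinus S) ∧ (∀ α, Q' α ∈ polyPlus S) ∧
          P + Q =
            spinorProd S (xiMinus S 0) (xiMinus S 1) * ∑ α, xiPlus S 1 α * P' α +
            spinorProd S (xiPlus S 0) (xiPlus S 1) * ∑ α, xiMinus S 1 α * Q' α) ∧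
        (∃ P' ∈ polyMinus S, H = spinorProd S (xiMinus S 0) (xiMinus S 1) * P') ∧
        (∃ Q' ∈ polyPlus S, G = spinorProd S (xiPlus S 0) (xiPlus S 1) * Q') ∧
        B = 0) := by
  obtain ⟨T, rfl⟩ := hS
  have hc := C_two_I_mul
  constructor
  · intro ω
    constructor
    · intro hω
      obtain ⟨p₀, p₁, p₂, p₃, p₄, rfl⟩ := exists_assemble t T ω
      rw [bOp_assemble] at hω
      obtain ⟨h₁, h₂, h₃, h₄, -⟩ := eq_zero_of_assemble_eq_zero hω
      obtain rfl := koszul_four p₄ h₄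
      obtain ⟨η₄, rfl⟩ := koszul_three p₃ (by rw [h₃]; exact zero_mem_Harm₂)
      obtain ⟨η₃, rfl⟩ := exists_eq_kos₃ p₂ h₂
      obtain ⟨H, G, B, η₂, hH, hG, hBx, hBy, rfl⟩ := exists_reprOne p₁ h₁
      obtain ⟨_, ⟨P, Q, hP, hQ, rfl⟩, η₁, rfl⟩ := koszul_zero p₀
      refine ⟨rotEquiv T P, (rotEquiv_mem_polyMinus t T P).2 hP,
        rotEquiv T Q, (rotEquiv_mem_polyPlus t T Q).2 hQ,
        rotEquiv T (MvPolynomial.C (-(Complex.I / 2)) * H), (rotEquiv_mem_polyMinus t T _).2 ?_,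
        rotEquiv T (MvPolynomial.C (-(Complex.I / 2)) * G), (rotEquiv_mem_polyPlus t T _).2 ?_,
        rotEquiv T (MvPolynomial.C (-(Complex.I / 2)) * -B), (rotEquiv_mem_polyTwo T _).2 ⟨?_, ?_⟩,
        assemble t T 0 η₁ η₂ η₃ η₄, ?_⟩
      · rw [killX_C_mul, hH]
      · rw [killY_C_mul, hG]
      · rw [killX_C_mul, map_neg killX, hBx]
      · rw [killY_C_mul, map_neg killY, hBy]
      · rw [representative_eq_assemble, bOp_assemble]
        simp only [← mul_assoc, hc, one_mul, neg_neg]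
        rw [assemble_sub]
        simp only [add_sub_cancel_left, sub_zero]
    · rintro ⟨P, -, Q, -, H, -, G, -, B, -, η, hη⟩
      obtain ⟨P, rfl⟩ := (rotEquiv T).surjective P
      obtain ⟨Q, rfl⟩ := (rotEquiv T).surjective Q
      obtain ⟨H, rfl⟩ := (rotEquiv T).surjective H
      obtain ⟨G, rfl⟩ := (rotEquiv T).surjective G
      obtain ⟨B, rfl⟩ := (rotEquiv T).surjective B
      rw [eq_add_of_sub_eq hη, map_add, bOp_bOp, zero_add, representative_eq_assemble,
        bOp_assemble, kos₁_reprOne]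
      simp only [Matrix.mulVec_zero, assemble_zero]
  · intro P hP Q hQ H hH G hG B hB
    obtain ⟨P, rfl⟩ := (rotEquiv T).surjective P
    obtain ⟨Q, rfl⟩ := (rotEquiv T).surjective Q
    obtain ⟨H, rfl⟩ := (rotEquiv T).surjective H
    obtain ⟨G, rfl⟩ := (rotEquiv T).surjective G
    obtain ⟨B, rfl⟩ := (rotEquiv T).surjective B
    rw [rotEquiv_mem_polyMinus] at hP hH
    rw [rotEquiv_mem_polyPlus] at hQ hG
    rw [rotEquiv_mem_polyTwo] at hB
    obtain ⟨hBx, hBy⟩ := hB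
    rw [cohEquiv_zero_iff, reprZero_eq_iff hP hQ, reprOne_eq_iff (by rw [killX_C_mul, hH])
      (by rw [killY_C_mul, hG]) (by rw [map_neg, killX_C_mul, hBx])
      (by rw [map_neg, killY_C_mul, hBy]), spinorProd_minus, spinorProd_plus]
    refine and_congr ?_ (and_congr ?_ (and_congr ?_ ?_))
    · exact zero_form_boundary_iff t T _ |>.trans (by rw [map_add])
    · exact exists_mul_iff T (rotEquiv_mem_polyMinus t T) _ _
    · exact exists_mul_iff T (rotEquiv_mem_polyPlus t T) _ _
    · rw [map_eq_zero_iff _ (rotEquiv T).injective, neg_eq_zero]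
      refine ⟨fun h => ?_, fun h => by rw [h, mul_zero]⟩
      linear_combination MvPolynomial.C (-(Complex.I / 2)) * h - B * hc
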